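/- Let $d\ge 1$, let $|n|$ be the Euclidean norm of $n\in\mathbb Z^d$, let $\mathcal H^1=\{u\in\ell^2(\mathbb Z^d):\|u\|_1^2:=\sum_n(1+|n|^2)|u_n|^2<\infty\}$, let $\|\cdot\|_0$ be the norm of $\ell^2(\mathbb Z^d)$, and let $Q$ be the operator $(Qu)_n=\sqrt{1+|n|^2}\,u_n$ with domain $D(Q)=\mathcal H^1$. Let $H$ be a (possibly unbounded) self-adjoint operator on $\ell^2(\mathbb Z^d)$ such that $[Q,H]$ extends to a bounded operator; that is, the finitely supported sequences form a core of $H$ (as is automatic for bounded $H$ and for every $-\Delta+V$ with real $V$) and, for some bounded $C$, $\langle Qx,Hy\rangle-\langle Hx,Qy\rangle=\langle x,Cy\rangle$ for all $x,y\in D(Q)\cap D(H)$. Let $\mathcal H_{\rm ac}(H)$ be the absolutely continuous subspace of $H$. Let $I\subset\mathbb R$ be a Borel set with $\mathrm{Leb}(I\cap\sigma(H))>0$ and let $\theta>0$ be such that the strict Mourre estimate $$\chi_I(H)\,[H,[H,-Q^2]]\,\chi_I(H)\ \ge\ \theta\,\chi_I(H)$$ holds on $\ell^2(\mathbb Z^d)$.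 Here $[H,[H,-Q^2]]$ stands for a bounded operator $B$ that extends the double commutator: with $a(x,y)=\langle Qx,QHy\rangle-\langle QHx,Qy\rangle$ (the form of $[H,-Q^2]$), one has $\langle x,By\rangle=a(Hx,y)-a(x,Hy)$ for all $x,y\in D(H^2)$ with $x,Hx,H^2x,y,Hy,H^2y\in\mathcal H^1$. Then for every $u\in\mathcal H^1\cap\mathcal H_{\rm ac}(H)$ one has $e^{-itH}u\in\mathcal H^1$ for all $t\in\mathbb R$, and $$\frac{\|e^{-itH}u\|_1}{t}\ \ge\ c\,\theta^{1/2}\,\|\chi_I(H)u\|_0\qquad\text{for all sufficiently large } t>0\ (t\ge T),$$ where $c>0$ is a universal constant (independent of $d,H,I,\theta,u$), while $T$ may depend on $u$ and on the other data. Consequently the same bound holds for all $t>0$ with $c$ replaced by some constant $c'>0$ that may depend on $u$ and on the other data. -/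

import Mathlib

open MeasureTheory Filter Topology
open scoped InnerProductSpace

noncomputable section

namespace Ballistic

/-! ### Borel functional calculus of a self-adjoint operator -/

section Calculus

variable {E : Type*} [NormedAddCommGroup E] [InnerProductSpace ℂ E] [CompleteSpace E]

/-- Bounded Borel functions on the real line. -/
def BddBorel (f : ℝ → ℂ) : Prop :=
  Measurable f ∧ ∃ M : ℝ, ∀ s, ‖f s‖ ≤ M

/-- `Φ` is the bounded Borel functional calculus `f ↦ f(H)` of the (possibly unbounded)
operator `H`: on bounded Borel functions it is a unital `*`-homomorphism which turns bounded
pointwise convergence into strong convergence, and it sends `s ↦ (s - z)⁻¹` to the resolvent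
`(H - z)⁻¹` for every non-real `z`.  By the spectral theorem, every self-adjoint `H` has
exactly one such calculus (as far as bounded Borel functions are concerned). -/
structure IsBorelCalculus (H : E →ₗ.[ℂ] E) (Φ : (ℝ → ℂ) → (E →L[ℂ] E)) : Prop where
  map_const : ∀ a : ℂ, Φ (fun _ => a) = a • (1 : E →L[ℂ] E)
  map_add : ∀ f g, BddBorel f → BddBorel g → Φ (fun s => f s + g s) = Φ f + Φ g
  map_mul : ∀ f g, BddBorel f → BddBorel g → Φ (fun s => f s * g s) = Φ f * Φ g
  map_star : ∀ f, BddBorel f → Φ (fun s => star (f s)) = star (Φ f)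
  tendsto : ∀ (F : ℕ → ℝ → ℂ) (f : ℝ → ℂ) (M : ℝ), (∀ k, Measurable (F k)) →
    (∀ k s, ‖F k s‖ ≤ M) → (∀ s, Tendsto (fun k => F k s) atTop (𝓝 (f s))) →
    ∀ v, Tendsto (fun k => Φ (F k) v) atTop (𝓝 (Φ f v))
  resolvent : ∀ z : ℂ, z.im ≠ 0 → ∀ v : E,
    (Φ (fun s => ((s : ℂ) - z)⁻¹) v, v + z • Φ (fun s => ((s : ℂ) - z)⁻¹) v) ∈ H.graph

open Classical in
/-- `f(H)` for a self-adjoint operator `H` and a bounded Borel function `f`. -/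
def borelCalculus (H : E →ₗ.[ℂ] E) : (ℝ → ℂ) → (E →L[ℂ] E) :=
  if h : ∃ Φ, IsBorelCalculus H Φ then h.choose else 0

/-- The spectral projection `χ_I(H)`. -/
def spectralProj (H : E →ₗ.[ℂ] E) (I : Set ℝ) : E →L[ℂ] E :=
  borelCalculus H (I.indicator 1)

/-- The unitary group `e^{-itH}`. -/
def propagator (H : E →ₗ.[ℂ] E) (t : ℝ) : E →L[ℂ] E :=
  borelCalculus H (fun s => Complex.exp (-Complex.I * t * s))

/-- The absolutely continuous subspace: the vectors `u` whose spectral measure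
`s ↦ ‖χ_s(H) u‖²` vanishes on Lebesgue null sets. -/
def acSubspace (H : E →ₗ.[ℂ] E) : Submodule ℂ E where
  carrier := {u | ∀ s : Set ℝ, MeasurableSet s → volume s = 0 → spectralProj H s u = 0}
  add_mem' := by
    intro u v hu hv s hs h0
    rw [map_add, hu s hs h0, hv s hs h0, add_zero]
  zero_mem' := by
    intro s _ _
    exact map_zero _
  smul_mem' := by
    intro a u hu s hs h0
    rw [map_smul, hu s hs h0, smul_zero]

/-- The (real) spectrum of a closed operator: the `s` for which `H - s : D(H) → E` is not
bijective. -/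
def realSpectrum (H : E →ₗ.[ℂ] E) : Set ℝ :=
  {s | ¬ Function.Bijective (fun x : H.domain => H x - (s : ℂ) • (x : E))}

end Calculus

/-! ### Weighted spaces on the lattice -/

/-- `ℓ²(ℤ^d)`. -/
abbrev L2 (d : ℕ) : Type := lp (fun _ : Fin d → ℤ => ℂ) 2

/-- `1 + |n|²` with the Euclidean norm of `n ∈ ℤ^d`. -/
def bracketSq {d : ℕ} (n : Fin d → ℤ) : ℝ := 1 + ∑ j, (n j : ℝ) ^ 2

/-- The weighted space `𝓗¹(ℤ^d)`: all `u ∈ ℓ²(ℤ^d)` with `∑ (1 + |n|²) |u_n|² < ∞`. -/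
def weightedSpace (d : ℕ) : Submodule ℂ (L2 d) where
  carrier := {u | Summable fun n => bracketSq n * ‖u n‖ ^ 2}
  add_mem' := by
    intro u v hu hv
    have hb : ∀ n : Fin d → ℤ, 0 ≤ bracketSq n := fun n => by unfold bracketSq; positivity
    refine Summable.of_nonneg_of_le (fun n => mul_nonneg (hb n) (by positivity)) (fun n => ?_)
      ((Summable.add hu hv).mul_left 2)
    have h1 : ‖(u + v) n‖ ≤ ‖u n‖ + ‖v n‖ := by
      rw [lp.coeFn_add]; exact norm_add_le _ _
    have h2 : ‖(u + v) n‖ ^ 2 ≤ 2 * (‖u n‖ ^ 2 + ‖v n‖ ^ 2) := by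
      have h3 := pow_le_pow_left₀ (norm_nonneg _) h1 2
      nlinarith [sq_nonneg (‖u n‖ - ‖v n‖)]
    nlinarith [mul_le_mul_of_nonneg_left h2 (hb n)]
  zero_mem' := by
    simp
  smul_mem' := by
    intro a u hu
    refine (Summable.mul_left (‖a‖ ^ 2) hu).congr (fun n => ?_)
    rw [lp.coeFn_smul, Pi.smul_apply, norm_smul]
    ring

/-- The norm `‖u‖₁ = (∑ (1 + |n|²) |u_n|²)^{1/2}` on `𝓗¹(ℤ^d)`. -/
def weightedNorm {d : ℕ} (u : L2 d) : ℝ := √(∑' n, bracketSq n * ‖u n‖ ^ 2)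

theorem memℓp_weight {d : ℕ} (u : weightedSpace d) :
    Memℓp (fun n : Fin d → ℤ => ((√(bracketSq n) : ℝ) : ℂ) * (u : L2 d) n) 2 := by
  refine memℓp_gen (Summable.congr u.2 (fun n => ?_))
  have hb : 0 ≤ bracketSq n := by unfold bracketSq; positivity
  simp [mul_pow, Real.sq_sqrt hb]

/-- The weight operator `(Q u)_n = (1 + |n|²)^{1/2} u_n` with domain `𝓗¹(ℤ^d)`. -/
def weightOp (d : ℕ) : L2 d →ₗ.[ℂ] L2 d where
  domain := weightedSpace d
  toFun :=
    { toFun := fun u => ⟨fun n => ((√(bracketSq n) : ℝ) : ℂ) * (u : L2 d) n, memℓp_weight u⟩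
      map_add' := by
        intro u v
        ext n
        exact mul_add _ _ _
      map_smul' := by
        intro a u
        ext n
        simp [mul_left_comm] }

/-- Finitely supported sequences: the span of the standard basis of `ℓ²(ℤ^d)`. -/
def finitelySupported (d : ℕ) : Submodule ℂ (L2 d) :=
  Submodule.span ℂ (Set.range fun n : Fin d → ℤ => lp.single 2 n (1 : ℂ))

/-! ### Commutators -/

/-- `[Q, H]` extends to a bounded operator on `ℓ²(ℤ^d)`: the finitely supported sequences form
a core of `H` (automatic for bounded `H` and for all discrete Schrödinger operators), and the
commutator form `⟨x, [Q, H] y⟩ = ⟨Q x, H y⟩ - ⟨H x, Q y⟩` on `D(Q) ∩ D(H)` is that of a bounded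
operator. -/
def HasBoundedCommutator {d : ℕ} (H : L2 d →ₗ.[ℂ] L2 d) : Prop :=
  H.HasCore (finitelySupported d) ∧
  ∃ C : L2 d →L[ℂ] L2 d, ∀ (x y : (weightOp d).domain) (x' y' : L2 d),
    ((x : L2 d), x') ∈ H.graph → ((y : L2 d), y') ∈ H.graph →
      ⟪(x : L2 d), C y⟫_ℂ = ⟪weightOp d x, y'⟫_ℂ - ⟪x', weightOp d y⟫_ℂ

/-- The sesquilinear form `⟨x, [H, -Q²] y⟩ = ⟨Q x, Q H y⟩ - ⟨Q H x, Q y⟩`, as a function of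
`x`, `x' = H x`, `y`, `y' = H y`, all of them in `D(Q)`. -/
def commForm {d : ℕ} (x x' y y' : (weightOp d).domain) : ℂ :=
  ⟪weightOp d x, weightOp d y'⟫_ℂ - ⟪weightOp d x', weightOp d y⟫_ℂ

/-- `B` is the bounded operator on `ℓ²(ℤ^d)` to which `[H, [H, -Q²]]` extends:
`⟨x, B y⟩ = ⟨H x, [H, -Q²] y⟩ - ⟨x, [H, -Q²] H y⟩` for all `x`, `y` such that `x`, `H x`, `H² x`
and `y`, `H y`, `H² y` are defined and lie in `D(Q)`; here `xᵢ = Hⁱ x` and `yᵢ = Hⁱ y`. -/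
def IsDoubleCommutator {d : ℕ} (H : L2 d →ₗ.[ℂ] L2 d) (B : L2 d →L[ℂ] L2 d) : Prop :=
  ∀ x₀ x₁ x₂ y₀ y₁ y₂ : (weightOp d).domain,
    ((x₀ : L2 d), (x₁ : L2 d)) ∈ H.graph → ((x₁ : L2 d), (x₂ : L2 d)) ∈ H.graph →
    ((y₀ : L2 d), (y₁ : L2 d)) ∈ H.graph → ((y₁ : L2 d), (y₂ : L2 d)) ∈ H.graph →
      ⟪(x₀ : L2 d), B y₀⟫_ℂ = commForm x₁ x₂ y₀ y₁ - commForm x₀ x₁ y₁ y₂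

/-- The strict Mourre estimate `χ_I(H) [H, [H, -Q²]] χ_I(H) ≥ θ χ_I(H)` on `ℓ²(ℤ^d)`. -/
def StrictMourreEstimate {d : ℕ} (H : L2 d →ₗ.[ℂ] L2 d) (I : Set ℝ) (θ : ℝ) : Prop :=
  ∃ B : L2 d →L[ℂ] L2 d, IsDoubleCommutator H B ∧
    (θ : ℂ) • spectralProj H I ≤ spectralProj H I * B * spectralProj H I

end Ballistic

end

open MeasureTheory Filter Topology
open scoped InnerProductSpace

noncomputable section

namespace Ballistic

/-! Write `P` = χ_I(H), `u_t` = e^{-itH}u and let `B` be the bounded double commutator. Formally,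
the second derivative of ‖Q w_t‖² in t is ⟨w_t, B w_t⟩. If w lies in the range of `P`, so does w_t,
and the Mourre estimate bounds this below by θ‖w‖²; hence ‖Q w_t‖² grows at least like θ‖w‖²t²/2.

The choice w = Pu is not available: `P` need not preserve 𝓗¹, and the second derivative requires Hw
and H²w in 𝓗¹ as well. Instead w = f(H)u, where f(H)u is close to Pu, |f| ≤ 2, and f(H), Hf(H),
H²f(H) all have bounded commutators with Q (`exists_approx_smooth`). As `B` is bounded, the distance
from w to the range of `P` costs only part of θ (`re_inner_ge_of_mourre`), and
`norm_weightOp_orbit_sq_ge` gives quadratic growth. To return to u, note that Q w_t = f(H) Q u_t +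
[Q, f(H)] u_t, so ‖Q w_t‖ ≤ 2‖Q u_t‖ + M‖u‖ (`norm_weightOp_orbit_le`). The additive term is
constant in t and the factor 2 is absolute, which is why c is universal and only T depends on the
data.

The commutators are controlled through bounded cutoffs Q_k = Q S_k with S_k = (1 + Q/(k+1))⁻¹, for
which [Q_k, H] = S_k C S_k uniformly in k. This yields bounds for resolvents, then for e^{-itH} as
the limit of (1 + itH/j)^{-j}, and, by Stone–Weierstrass applied to the Cayley transform, for enough
functions f to approximate χ_I strongly.

Since `borelCalculus` is defined by choice, the spectral theorem is also proved: the continuous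
calculus of the unitary Cayley transform is extended to Borel functions by L²-density with respect
to its spectral measures, then pulled back to the line (`exists_isBorelCalculus`). -/

section Calculus

variable {E : Type*} [NormedAddCommGroup E] [InnerProductSpace ℂ E] [CompleteSpace E]

/-! ### Consequences of the axioms of a Borel calculus. -/

namespace BddBorel

variable {f g : ℝ → ℂ}

theorem const (a : ℂ) : BddBorel fun _ => a := ⟨measurable_const, ‖a‖, fun _ => le_rfl⟩

theorem add (hf : BddBorel f) (hg : BddBorel g) : BddBorel fun s => f s + g s := by
  obtain ⟨hf, M, hM⟩ := hf
  obtain ⟨hg, N, hN⟩ := hg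
  exact ⟨hf.add hg, M + N, fun s => (norm_add_le _ _).trans (add_le_add (hM s) (hN s))⟩

theorem mul (hf : BddBorel f) (hg : BddBorel g) : BddBorel fun s => f s * g s := by
  obtain ⟨hf, M, hM⟩ := hf
  obtain ⟨hg, N, hN⟩ := hg
  refine ⟨hf.mul hg, M * N, fun s => ?_⟩
  rw [norm_mul]
  exact mul_le_mul (hM s) (hN s) (norm_nonneg _) ((norm_nonneg _).trans (hM s))

theorem star (hf : BddBorel f) : BddBorel fun s => star (f s) := by
  obtain ⟨hf, M, hM⟩ := hf
  exact ⟨Complex.continuous_conj.measurable.comp hf, M, fun s => by simpa using hM s⟩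

theorem pow (hf : BddBorel f) (n : ℕ) : BddBorel fun s => f s ^ n := by
  induction n with
  | zero => simpa using const 1
  | succ n ih => simpa only [pow_succ] using ih.mul hf

theorem indicator {I : Set ℝ} (hI : MeasurableSet I) : BddBorel (I.indicator 1) := by
  refine ⟨measurable_one.indicator hI, 1, fun s => ?_⟩
  by_cases h : s ∈ I <;> simp [h]

end BddBorel

namespace IsBorelCalculus

variable {H : E →ₗ.[ℂ] E} {Φ : (ℝ → ℂ) → (E →L[ℂ] E)} (hΦ : IsBorelCalculus H Φ)
include hΦ

theorem map_smul {f : ℝ → ℂ} (hf : BddBorel f) (a : ℂ) :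
    Φ (fun s => a * f s) = a • Φ f := by
  rw [hΦ.map_mul _ _ (BddBorel.const a) hf, hΦ.map_const, smul_mul_assoc, one_mul]

theorem map_sub {f g : ℝ → ℂ} (hf : BddBorel f) (hg : BddBorel g) :
    Φ (fun s => f s - g s) = Φ f - Φ g := by
  have h := hΦ.map_add _ _ hf ((BddBorel.const (-1)).mul hg)
  rw [hΦ.map_smul hg, neg_one_smul, ← sub_eq_add_neg] at h
  rw [← h]
  congr 1
  ext s
  ring

theorem map_pow {f : ℝ → ℂ} (hf : BddBorel f) (n : ℕ) : Φ (fun s => f s ^ n) = Φ f ^ n := by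
  induction n with
  | zero => simpa using hΦ.map_const 1
  | succ n ih =>
    simp only [pow_succ]
    rw [hΦ.map_mul _ _ (hf.pow n) hf, ih]

theorem mul_apply {f g : ℝ → ℂ} (hf : BddBorel f) (hg : BddBorel g) (v : E) :
    Φ f (Φ g v) = Φ (fun s => f s * g s) v := by
  rw [hΦ.map_mul _ _ hf hg]; rfl

theorem comm_apply {f g : ℝ → ℂ} (hf : BddBorel f) (hg : BddBorel g) (v : E) :
    Φ f (Φ g v) = Φ g (Φ f v) := by
  rw [hΦ.mul_apply hf hg, hΦ.mul_apply hg hf]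
  simp only [mul_comm]

theorem inner_map_map {f g : ℝ → ℂ} (hf : BddBorel f) (hg : BddBorel g) (v w : E) :
    ⟪Φ f v, Φ g w⟫_ℂ = ⟪v, Φ (fun s => star (f s) * g s) w⟫_ℂ := by
  rw [hΦ.map_mul _ _ hf.star hg, hΦ.map_star _ hf, ContinuousLinearMap.star_eq_adjoint,
    mul_apply_eq_comp, ContinuousLinearMap.adjoint_inner_right]

/-- With g = √(M² - |f|²) one has |f|² + |g|² = M², so ‖f(H)v‖² + ‖g(H)v‖² = M²‖v‖²; only the
algebraic axioms enter. -/
theorem norm_apply_le {f : ℝ → ℂ} (hf : Measurable f) {M : ℝ} (hM : ∀ s, ‖f s‖ ≤ M) (v : E) :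
    ‖Φ f v‖ ≤ M * ‖v‖ := by
  have hM0 : 0 ≤ M := (norm_nonneg _).trans (hM 0)
  have hf' : BddBorel f := ⟨hf, M, hM⟩
  set g : ℝ → ℂ := fun s => ((√(M ^ 2 - ‖f s‖ ^ 2) : ℝ) : ℂ) with hg
  have hg' : BddBorel g := by
    refine ⟨by fun_prop, M, fun s => ?_⟩
    rw [hg, Complex.norm_real, Real.norm_of_nonneg (Real.sqrt_nonneg _)]
    exact Real.sqrt_le_iff.2 ⟨hM0, by nlinarith [sq_nonneg ‖f s‖]⟩
  have key : ⟪Φ f v, Φ f v⟫_ℂ + ⟪Φ g v, Φ g v⟫_ℂ = ((M ^ 2 : ℝ) : ℂ) * ⟪v, v⟫_ℂ := by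
    rw [hΦ.inner_map_map hf' hf', hΦ.inner_map_map hg' hg', ← inner_add_right,
      ← add_apply, ← hΦ.map_add _ _ (hf'.star.mul hf') (hg'.star.mul hg')]
    have : (fun s => star (f s) * f s + star (g s) * g s) = fun _ => ((M ^ 2 : ℝ) : ℂ) := by
      ext s
      have h1 : star (f s) * f s = ((‖f s‖ ^ 2 : ℝ) : ℂ) := by
        simpa using Complex.conj_mul' (f s)
      have h2 : star (g s) * g s = ((M ^ 2 - ‖f s‖ ^ 2 : ℝ) : ℂ) := by
        rw [hg]
        simp only [RCLike.star_def, Complex.conj_ofReal]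
        rw [← Complex.ofReal_mul, Real.mul_self_sqrt]
        have := hM s
        nlinarith [norm_nonneg (f s)]
      rw [h1, h2, ← Complex.ofReal_add]
      congr 1
      ring
    rw [this, hΦ.map_const]
    simp [inner_smul_right]
  simp only [inner_self_eq_norm_sq_to_K] at key
  have key' : ‖Φ f v‖ ^ 2 + ‖Φ g v‖ ^ 2 = M ^ 2 * ‖v‖ ^ 2 := by
    apply Complex.ofReal_injective
    push_cast
    simpa using key
  refine abs_le_of_sq_le_sq' ?_ (by positivity) |>.2
  nlinarith [sq_nonneg ‖Φ g v‖]

theorem norm_map_le {f : ℝ → ℂ} (hf : Measurable f) {M : ℝ} (hM : ∀ s, ‖f s‖ ≤ M) :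
    ‖Φ f‖ ≤ M :=
  ContinuousLinearMap.opNorm_le_bound _ ((norm_nonneg _).trans (hM 0)) (hΦ.norm_apply_le hf hM)

/-- Dominated convergence for the functional calculus along a countably generated filter. -/
theorem tendsto_filter {ι : Type*} {l : Filter ι} [l.IsCountablyGenerated] {F : ι → ℝ → ℂ}
    {f : ℝ → ℂ} {M : ℝ} (hF : ∀ i, Measurable (F i)) (hM : ∀ᶠ i in l, ∀ s, ‖F i s‖ ≤ M)
    (h : ∀ s, Tendsto (fun i => F i s) l (𝓝 (f s))) (v : E) :
    Tendsto (fun i => Φ (F i) v) l (𝓝 (Φ f v)) := by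
  refine tendsto_of_seq_tendsto fun x hx => ?_
  obtain ⟨N, hN⟩ := eventually_atTop.1 (hx.eventually hM)
  rw [← tendsto_add_atTop_iff_nat N]
  exact hΦ.tendsto (fun k => F (x (k + N))) f M (fun k => hF _) (fun k s => hN _ (by omega) s)
    (fun s => ((h s).comp hx).comp (tendsto_add_atTop_nat N)) v

/-! ### Spectral measures -/

/-- Indicators are real and idempotent, so ‖χ_A(H)u‖² = ⟨u, χ_A(H)u⟩ is finitely additive in A; the
convergence axiom applied to partial unions makes it countably additive. -/
theorem map_indicator_iUnion (A : ℕ → Set ℝ) (hA : ∀ k, MeasurableSet (A k))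
    (hd : Pairwise (Function.onFun Disjoint A)) (u : E) :
    HasSum (fun k => ‖Φ ((A k).indicator 1) u‖ ^ 2) (‖Φ ((⋃ k, A k).indicator 1) u‖ ^ 2) := by
  have hsq : ∀ B : Set ℝ, MeasurableSet B →
      ((‖Φ (B.indicator 1) u‖ ^ 2 : ℝ) : ℂ) = ⟪u, Φ (B.indicator 1) u⟫_ℂ := fun B hB => by
    have h := hΦ.inner_map_map (BddBorel.indicator hB) (BddBorel.indicator hB) u u
    rw [inner_self_eq_norm_sq_to_K] at h
    have h' : (fun s => star ((B.indicator 1 : ℝ → ℂ) s) * (B.indicator 1 : ℝ → ℂ) s)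
        = B.indicator 1 := by
      ext s
      by_cases hs : s ∈ B <;> simp [hs]
    rw [h'] at h
    exact_mod_cast h
  have hU : MeasurableSet (⋃ k, A k) := MeasurableSet.iUnion hA
  rw [hasSum_iff_tendsto_nat_of_nonneg fun _ => sq_nonneg _]
  have hpart : ∀ n : ℕ, ∑ k ∈ Finset.range n, ‖Φ ((A k).indicator 1) u‖ ^ 2 =
      ‖Φ ((⋃ k ∈ Finset.range n, A k).indicator 1) u‖ ^ 2 := by
    intro n
    induction n with
    | zero =>
      have := hΦ.map_const 0
      simp only [zero_smul] at this
      simp only [Finset.range_zero, Finset.sum_empty, Finset.notMem_empty, Set.iUnion_false,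
        Set.iUnion_empty, Set.indicator_empty]
      simp [this]
    | succ n ih =>
      rw [Finset.sum_range_succ, ih]
      have hB : MeasurableSet (⋃ k ∈ Finset.range n, A k) :=
        Finset.measurableSet_biUnion _ fun k _ => hA k
      have hdis : Disjoint (⋃ k ∈ Finset.range n, A k) (A n) := by
        simp only [Set.disjoint_iUnion_left]
        intro k hk
        exact hd (by simp at hk; omega)
      have hun : (⋃ k ∈ Finset.range (n + 1), A k) = (⋃ k ∈ Finset.range n, A k) ∪ A n := by
        rw [Finset.range_add_one, Finset.set_biUnion_insert, Set.union_comm]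
      have hind : ((⋃ k ∈ Finset.range n, A k) ∪ A n).indicator (1 : ℝ → ℂ) =
          fun s => (⋃ k ∈ Finset.range n, A k).indicator 1 s + (A n).indicator 1 s := by
        rw [Set.indicator_union_of_disjoint hdis]
      have hc : ∀ a b c : ℝ, ((a : ℝ) : ℂ) + (b : ℂ) = c → a + b = c := fun a b c h => by
        exact_mod_cast h
      apply hc
      rw [hsq _ hB, hsq _ (hA n), hsq _ (by rw [hun]; exact hB.union (hA n)), hun, hind,
        hΦ.map_add _ _ (BddBorel.indicator hB) (BddBorel.indicator (hA n)),
        add_apply, inner_add_right]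
  simp only [hpart]
  refine ((hΦ.tendsto _ _ 1 (fun n => ?_) (fun n s => ?_) (fun s => ?_) u).norm).pow 2
  · exact (BddBorel.indicator (Finset.measurableSet_biUnion _ fun k _ => hA k)).1
  · by_cases h : s ∈ ⋃ k ∈ Finset.range n, A k <;> simp only [h, Set.indicator_of_mem,
      Set.indicator_of_notMem, not_false_eq_true] <;> simp
  · by_cases h : s ∈ ⋃ k, A k
    · obtain ⟨k, hk⟩ := Set.mem_iUnion.1 h
      refine tendsto_const_nhds.congr' ?_
      filter_upwards [eventually_gt_atTop k] with n hn
      rw [Set.indicator_of_mem h, Set.indicator_of_mem]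
      exact Set.mem_biUnion (Finset.mem_coe.2 (Finset.mem_range.2 hn)) hk
    · refine tendsto_const_nhds.congr fun n => ?_
      rw [Set.indicator_of_notMem h, Set.indicator_of_notMem]
      intro h'
      simp only [Set.mem_iUnion] at h' h
      obtain ⟨k, _, hk⟩ := h'
      exact h ⟨k, hk⟩

/-- The spectral measure `A ↦ ‖χ_A(H) u‖²`. -/
theorem exists_spectralMeasure (u : E) : ∃ μ : Measure ℝ, IsFiniteMeasure μ ∧
    ∀ A, MeasurableSet A → μ A = ENNReal.ofReal (‖Φ (A.indicator 1) u‖ ^ 2) := by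
  have h0 : Φ (fun _ => 0) = 0 := by simpa using hΦ.map_const 0
  refine ⟨Measure.ofMeasurable (fun A _ => ENNReal.ofReal (‖Φ (A.indicator 1) u‖ ^ 2))
    (by rw [Set.indicator_empty, h0]; simp) (fun A hA hd => ?_), ⟨?_⟩,
    fun A hA => Measure.ofMeasurable_apply A hA⟩
  · have h := hΦ.map_indicator_iUnion A hA hd u
    rw [← h.tsum_eq, ENNReal.ofReal_tsum_of_nonneg (fun _ => sq_nonneg _) h.summable]
  · rw [Measure.ofMeasurable_apply _ MeasurableSet.univ]
    exact ENNReal.ofReal_lt_top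

end IsBorelCalculus

end Calculus

/-! ### The weight, its cutoffs, and commutators with it. -/

section Lattice

variable {d : ℕ}

theorem hasSum_norm_sq (x : L2 d) : HasSum (fun n => ‖x n‖ ^ 2) (‖x‖ ^ 2) := by
  simpa using lp.hasSum_norm (p := 2) (by simp) x

theorem norm_le_of_sum_le {x : L2 d} {M : ℝ} (hM : 0 ≤ M)
    (h : ∀ s : Finset (Fin d → ℤ), ∑ n ∈ s, ‖x n‖ ^ 2 ≤ M ^ 2) : ‖x‖ ≤ M :=
  lp.norm_le_of_forall_sum_le (p := 2) (by simp) hM fun s => by simpa using h s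

theorem bracketSq_nonneg (n : Fin d → ℤ) : 0 ≤ bracketSq n := by
  unfold bracketSq; positivity

/-- The weight `(1 + |n|²)^{1/2}`. -/
def bracket (n : Fin d → ℤ) : ℝ := √(bracketSq n)

theorem one_le_bracket (n : Fin d → ℤ) : 1 ≤ bracket n := by
  rw [bracket, Real.one_le_sqrt, bracketSq]
  have : 0 ≤ ∑ j, (n j : ℝ) ^ 2 := by positivity
  linarith

theorem bracket_pos (n : Fin d → ℤ) : 0 < bracket n := one_pos.trans_le (one_le_bracket n)

theorem weightOp_apply (x : (weightOp d).domain) (n : Fin d → ℤ) :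
    weightOp d x n = ((bracket n : ℝ) : ℂ) * (x : L2 d) n := rfl

theorem norm_weightOp_apply (x : (weightOp d).domain) (n : Fin d → ℤ) :
    ‖weightOp d x n‖ = bracket n * ‖(x : L2 d) n‖ := by
  rw [weightOp_apply, norm_mul, Complex.norm_real, Real.norm_of_nonneg (bracket_pos n).le]

theorem norm_le_norm_weightOp (x : (weightOp d).domain) : ‖(x : L2 d)‖ ≤ ‖weightOp d x‖ := by
  refine norm_le_of_sum_le (norm_nonneg _) fun s => ?_
  refine (Finset.sum_le_sum fun n _ => ?_).trans
    (sum_le_hasSum s (fun _ _ => sq_nonneg _) (hasSum_norm_sq (weightOp d x)))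
  rw [norm_weightOp_apply]
  gcongr
  exact le_mul_of_one_le_left (norm_nonneg _) (one_le_bracket n)

theorem weightedNorm_eq_norm (x : (weightOp d).domain) :
    weightedNorm (x : L2 d) = ‖weightOp d x‖ := by
  rw [weightedNorm, Real.sqrt_eq_iff_eq_sq (tsum_nonneg fun n => mul_nonneg (bracketSq_nonneg n)
    (sq_nonneg _)) (norm_nonneg _), ← (hasSum_norm_sq (weightOp d x)).tsum_eq]
  refine tsum_congr fun n => ?_
  rw [norm_weightOp_apply, mul_pow, bracket, Real.sq_sqrt (bracketSq_nonneg n)]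

/-! ### Diagonal operators -/

/-- The diagonal operator with bounded real coefficients `a`. -/
def diagOp (a : (Fin d → ℤ) → ℝ) (M : ℝ) (ha : ∀ n, |a n| ≤ M) : L2 d →L[ℂ] L2 d :=
  have hle : ∀ (x : L2 d) n, ‖((a n : ℝ) : ℂ) * x n‖ ≤ ‖((M : ℂ) • x) n‖ := fun x n => by
    rw [lp.coeFn_smul, Pi.smul_apply, smul_eq_mul, norm_mul, norm_mul, Complex.norm_real,
      Complex.norm_real, Real.norm_eq_abs, Real.norm_eq_abs]
    exact mul_le_mul_of_nonneg_right ((ha n).trans (le_abs_self M)) (norm_nonneg _)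
  LinearMap.mkContinuous
    { toFun := fun x => ⟨fun n => ((a n : ℝ) : ℂ) * x n, by
        refine memℓp_gen (Summable.of_nonneg_of_le (fun n => by positivity) (fun n => ?_)
          ((lp.memℓp ((M : ℂ) • x)).summable (by simp)))
        exact Real.rpow_le_rpow (norm_nonneg _) (hle x n) (by simp)⟩
      map_add' := by
        intro u v
        ext n
        exact mul_add _ _ _
      map_smul' := by
        intro c u
        ext n
        simp [mul_left_comm] }
    |M| (fun x => by
      have : |M| * ‖x‖ = ‖(M : ℂ) • x‖ := by rw [norm_smul, Complex.norm_real, Real.norm_eq_abs]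
      rw [this]
      refine norm_le_of_sum_le (norm_nonneg _) fun s => ?_
      refine (Finset.sum_le_sum fun n _ => ?_).trans
        (sum_le_hasSum s (fun _ _ => sq_nonneg _) (hasSum_norm_sq ((M : ℂ) • x)))
      exact pow_le_pow_left₀ (norm_nonneg _) (hle x n) 2)

variable {a : (Fin d → ℤ) → ℝ} {M : ℝ} {ha : ∀ n, |a n| ≤ M}

theorem diagOp_apply (x : L2 d) (n : Fin d → ℤ) : diagOp a M ha x n = ((a n : ℝ) : ℂ) * x n := rfl

theorem norm_diagOp_apply (x : L2 d) (n : Fin d → ℤ) :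
    ‖diagOp a M ha x n‖ = |a n| * ‖x n‖ := by
  rw [diagOp_apply, norm_mul, Complex.norm_real, Real.norm_eq_abs]

theorem norm_diagOp_le (x : L2 d) : ‖diagOp a M ha x‖ ≤ M * ‖x‖ := by
  have hM : 0 ≤ M := (abs_nonneg _).trans (ha 0)
  refine norm_le_of_sum_le (by positivity) fun s => ?_
  rw [mul_pow]
  refine (Finset.sum_le_sum fun n _ => ?_).trans
    (sum_le_hasSum s (fun n _ => by positivity) ((hasSum_norm_sq x).mul_left (M ^ 2)))
  rw [norm_diagOp_apply, mul_pow]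
  gcongr
  exact ha n

theorem inner_diagOp_left (x y : L2 d) : ⟪diagOp a M ha x, y⟫_ℂ = ⟪x, diagOp a M ha y⟫_ℂ := by
  rw [lp.inner_eq_tsum, lp.inner_eq_tsum]
  refine tsum_congr fun n => ?_
  rw [diagOp_apply, diagOp_apply]
  simp only [RCLike.inner_apply, map_mul, Complex.conj_ofReal]
  ring

theorem diagOp_mem_finitelySupported {x : L2 d} (hx : x ∈ finitelySupported d) :
    diagOp a M ha x ∈ finitelySupported d := by
  induction hx using Submodule.span_induction with
  | mem x hx =>
    obtain ⟨n, rfl⟩ := hx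
    have : diagOp a M ha (lp.single 2 n (1 : ℂ)) = ((a n : ℝ) : ℂ) • lp.single 2 n (1 : ℂ) := by
      ext m
      rw [diagOp_apply, lp.coeFn_smul, Pi.smul_apply, smul_eq_mul]
      by_cases h : m = n
      · rw [h]
      · simp [lp.single_apply, h]
    rw [this]
    exact Submodule.smul_mem _ _ (Submodule.subset_span ⟨n, rfl⟩)
  | zero => rw [map_zero]; exact Submodule.zero_mem _
  | add x y _ _ hx hy => rw [map_add]; exact Submodule.add_mem _ hx hy
  | smul c x _ hx => rw [map_smul]; exact Submodule.smul_mem _ _ hx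

theorem finitelySupported_le : finitelySupported d ≤ (weightOp d).domain := by
  refine Submodule.span_le.2 ?_
  rintro _ ⟨n, rfl⟩
  refine summable_of_ne_finset_zero (s := {n}) fun m hm => ?_
  rw [Finset.mem_singleton] at hm
  simp [lp.single_apply, hm]

/-! ### Bounded cutoffs of the weight -/

theorem cutoff_aux (k : ℕ) (n : Fin d → ℤ) :
    |(k + 1) * bracket n / (k + 1 + bracket n)| ≤ k + 1 := by
  have := bracket_pos n
  rw [abs_of_nonneg (by positivity), div_le_iff₀ (by positivity)]
  nlinarith [sq_nonneg ((k : ℝ) + 1)]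

theorem smoothing_aux (k : ℕ) (n : Fin d → ℤ) :
    |((k : ℝ) + 1) / (k + 1 + bracket n)| ≤ 1 := by
  have := bracket_pos n
  rw [abs_of_nonneg (by positivity), div_le_iff₀ (by positivity)]
  linarith

variable (d) in
/-- The bounded operator `Q (1 + Q / (k + 1))⁻¹`. -/
def cutoff (k : ℕ) : L2 d →L[ℂ] L2 d :=
  diagOp (fun n => (k + 1) * bracket n / (k + 1 + bracket n)) (k + 1) (cutoff_aux k)

variable (d) in
/-- The contraction `(1 + Q / (k + 1))⁻¹`. -/
def smoothing (k : ℕ) : L2 d →L[ℂ] L2 d :=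
  diagOp (fun n => ((k : ℝ) + 1) / (k + 1 + bracket n)) 1 (smoothing_aux k)

theorem norm_smoothing_le (k : ℕ) : ‖smoothing d k‖ ≤ 1 :=
  ContinuousLinearMap.opNorm_le_bound _ zero_le_one fun x => norm_diagOp_le x

theorem inner_cutoff_left (k : ℕ) (x y : L2 d) : ⟪cutoff d k x, y⟫_ℂ = ⟪x, cutoff d k y⟫_ℂ :=
  inner_diagOp_left x y

theorem inner_smoothing_left (k : ℕ) (x y : L2 d) :
    ⟪smoothing d k x, y⟫_ℂ = ⟪x, smoothing d k y⟫_ℂ :=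
  inner_diagOp_left x y

theorem smoothing_add_cutoff (k : ℕ) (x : L2 d) :
    x = smoothing d k x + ((k : ℂ) + 1)⁻¹ • cutoff d k x := by
  ext n
  have h1 := bracket_pos n
  have h2 : ((k : ℂ) + 1 + bracket n) ≠ 0 := by
    have : ((k : ℝ) + 1 + bracket n) ≠ 0 := by positivity
    exact_mod_cast this
  have h3 : ((k : ℂ) + 1) ≠ 0 := by exact_mod_cast Nat.succ_ne_zero k
  rw [lp.coeFn_add, lp.coeFn_smul, Pi.add_apply, Pi.smul_apply, smoothing, cutoff, diagOp_apply,
    diagOp_apply]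
  push_cast
  rw [smul_eq_mul]
  field_simp

theorem cutoff_eq_smoothing_weightOp (k : ℕ) (x : (weightOp d).domain) :
    cutoff d k x = smoothing d k (weightOp d x) := by
  ext n
  rw [smoothing, cutoff, diagOp_apply, diagOp_apply, weightOp_apply]
  push_cast
  ring

theorem weightOp_eq_cutoff (k : ℕ) (x : L2 d) (y : (weightOp d).domain)
    (hy : (y : L2 d) = smoothing d k x) : weightOp d y = cutoff d k x := by
  ext n
  rw [weightOp_apply, hy, smoothing, cutoff, diagOp_apply, diagOp_apply]
  push_cast
  ring

theorem tendsto_smoothing (x : L2 d) :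
    Tendsto (fun k => smoothing d k x) atTop (𝓝 x) := by
  have hk : ∀ k (n : Fin d → ℤ), ‖(smoothing d k x - x) n‖ =
      bracket n / (k + 1 + bracket n) * ‖x n‖ := fun k n => by
    have h1 := bracket_pos n
    have h2 : ((k : ℂ) + 1 + bracket n) ≠ 0 := by
      have : ((k : ℝ) + 1 + bracket n) ≠ 0 := by positivity
      exact_mod_cast this
    have : (smoothing d k x - x) n = ((-(bracket n / (k + 1 + bracket n)) : ℝ) : ℂ) * x n := by
      rw [lp.coeFn_sub, Pi.sub_apply, smoothing, diagOp_apply]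
      push_cast
      field_simp
      ring
    rw [this, norm_mul, Complex.norm_real, norm_neg, Real.norm_of_nonneg (by positivity)]
  have hsq : Tendsto (fun k => ‖smoothing d k x - x‖ ^ 2) atTop (𝓝 0) := by
    have := tendsto_tsum_of_dominated_convergence (𝓕 := atTop)
      (f := fun k n => ‖(smoothing d k x - x) n‖ ^ 2) (g := fun _ => 0)
      (hasSum_norm_sq x).summable (fun n => ?_) (Eventually.of_forall fun k n => ?_)
    · simpa only [(hasSum_norm_sq _).tsum_eq, tsum_zero] using this
    · simp only [hk]
      have h1 : Tendsto (fun k : ℕ => (k : ℝ) + 1 + bracket n) atTop atTop :=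
        tendsto_atTop_add_const_right _ _ (tendsto_atTop_add_const_right _ _
          tendsto_natCast_atTop_atTop)
      simpa using ((h1.const_div_atTop (bracket n)).mul_const ‖x n‖).pow 2
    · have h1 := bracket_pos n
      rw [hk, Real.norm_of_nonneg (by positivity)]
      gcongr
      refine mul_le_of_le_one_left (norm_nonneg _) ?_
      rw [div_le_one (by positivity)]
      have : (0 : ℝ) ≤ k := by positivity
      linarith
  rw [tendsto_iff_norm_sub_tendsto_zero]
  simpa using hsq.sqrt

theorem tendsto_cutoff (x : (weightOp d).domain) :
    Tendsto (fun k => cutoff d k x) atTop (𝓝 (weightOp d x)) := by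
  simp only [cutoff_eq_smoothing_weightOp]
  exact tendsto_smoothing _

theorem norm_cutoff_le (k : ℕ) (x : (weightOp d).domain) :
    ‖cutoff d k x‖ ≤ ‖weightOp d x‖ := by
  rw [cutoff_eq_smoothing_weightOp]
  simpa [smoothing] using norm_diagOp_le (ha := smoothing_aux k) (weightOp d x)

/-- A Fatou argument: the cutoff weights converge pointwise to the full weight, so every finite
partial sum of ‖Qx‖² is at most M². -/
theorem mem_domain_of_norm_cutoff_le {x : L2 d} {M : ℝ} (h : ∀ k, ‖cutoff d k x‖ ≤ M) :
    x ∈ (weightOp d).domain := by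
  have hs : ∀ s : Finset (Fin d → ℤ), ∑ n ∈ s, bracketSq n * ‖x n‖ ^ 2 ≤ M ^ 2 := fun s => by
    have hlim : Tendsto (fun k : ℕ => ∑ n ∈ s, ‖cutoff d k x n‖ ^ 2) atTop
        (𝓝 (∑ n ∈ s, bracketSq n * ‖x n‖ ^ 2)) := by
      refine tendsto_finsetSum _ fun n _ => ?_
      have h1 := bracket_pos n
      have h2 : Tendsto (fun k : ℕ => (k + 1) * bracket n / (k + 1 + bracket n)) atTop
          (𝓝 (bracket n)) := by
        have h3 : Tendsto (fun k : ℕ => (k : ℝ) + 1 + bracket n) atTop atTop :=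
          tendsto_atTop_add_const_right _ _ (tendsto_atTop_add_const_right _ _
            tendsto_natCast_atTop_atTop)
        have h4 := (tendsto_const_nhds (x := bracket n)).sub (h3.const_div_atTop (bracket n ^ 2))
        rw [sub_zero] at h4
        refine h4.congr fun k => ?_
        have : (k : ℝ) + 1 + bracket n ≠ 0 := by positivity
        field_simp
        ring
      have h5 := ((h2.abs).mul_const ‖x n‖).pow 2
      rw [abs_of_pos h1, mul_pow, bracket, Real.sq_sqrt (bracketSq_nonneg n)] at h5
      refine h5.congr fun k => ?_
      rw [cutoff, norm_diagOp_apply, bracket]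
    refine le_of_tendsto' hlim fun k => ?_
    refine (sum_le_hasSum s (fun _ _ => sq_nonneg _) (hasSum_norm_sq _)).trans ?_
    exact pow_le_pow_left₀ (norm_nonneg _) (h k) 2
  exact summable_of_sum_le (fun n => mul_nonneg (bracketSq_nonneg n) (sq_nonneg _)) hs

/-! ### Operators with bounded commutator with the weight -/

/-- The commutators of `A` with the cutoffs of `Q` are bounded by `M`, uniformly in the cutoff. -/
def CommutatorBound (A : L2 d →L[ℂ] L2 d) (M : ℝ) : Prop :=
  ∀ k x, ‖cutoff d k (A x) - A (cutoff d k x)‖ ≤ M * ‖x‖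

namespace CommutatorBound

variable {A B : L2 d →L[ℂ] L2 d} {K L : ℝ}

/-- Q_k A x = A Q_k x + [Q_k, A] x stays bounded in k once Qx exists. -/
theorem mem_domain (hA : CommutatorBound A K) (x : (weightOp d).domain) :
    A x ∈ (weightOp d).domain := by
  refine mem_domain_of_norm_cutoff_le (M := K * ‖(x : L2 d)‖ + ‖A‖ * ‖weightOp d x‖) fun k => ?_
  have h1 := hA k x
  have h2 : ‖A (cutoff d k x)‖ ≤ ‖A‖ * ‖weightOp d x‖ :=
    (A.le_opNorm _).trans (mul_le_mul_of_nonneg_left (norm_cutoff_le k x) (norm_nonneg _))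
  have h3 := norm_sub_norm_le (cutoff d k (A x)) (A (cutoff d k x))
  linarith

theorem norm_weightOp_sub_le (hA : CommutatorBound A K) (x y : (weightOp d).domain)
    (hy : (y : L2 d) = A x) : ‖weightOp d y - A (weightOp d x)‖ ≤ K * ‖(x : L2 d)‖ := by
  have h := ((tendsto_cutoff y).sub ((A.continuous.tendsto _).comp (tendsto_cutoff x))).norm
  refine le_of_tendsto' h fun k => ?_
  rw [hy]
  exact hA k x

theorem one : CommutatorBound (1 : L2 d →L[ℂ] L2 d) 0 := fun k x => by simp

theorem add (hA : CommutatorBound A K) (hB : CommutatorBound B L) :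
    CommutatorBound (A + B) (K + L) := fun k x => by
  have : cutoff d k ((A + B) x) - (A + B) (cutoff d k x) =
      (cutoff d k (A x) - A (cutoff d k x)) + (cutoff d k (B x) - B (cutoff d k x)) := by
    simp only [add_apply, map_add]
    abel
  rw [this, add_mul]
  exact (norm_add_le _ _).trans (add_le_add (hA k x) (hB k x))

theorem smul (hA : CommutatorBound A K) (c : ℂ) : CommutatorBound (c • A) (‖c‖ * K) :=
  fun k x => by
    have : cutoff d k ((c • A) x) - (c • A) (cutoff d k x) =
        c • (cutoff d k (A x) - A (cutoff d k x)) := by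
      simp [smul_sub]
    rw [this, norm_smul, mul_assoc]
    exact mul_le_mul_of_nonneg_left (hA k x) (norm_nonneg _)

theorem mul (hA : CommutatorBound A K) (hB : CommutatorBound B L) :
    CommutatorBound (A * B) (K * ‖B‖ + ‖A‖ * L) := fun k x => by
  have : cutoff d k ((A * B) x) - (A * B) (cutoff d k x) =
      (cutoff d k (A (B x)) - A (cutoff d k (B x))) + A (cutoff d k (B x) - B (cutoff d k x)) := by
    simp only [mul_apply_eq_comp, map_sub]
    abel
  -- Testing the bound on a unit vector forces K ≥ 0.
  have hK : 0 ≤ K := by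
    have := (norm_nonneg _).trans (hA 0 (lp.single 2 0 1))
    simpa [lp.norm_single] using this
  rw [this, add_mul]
  refine (norm_add_le _ _).trans (add_le_add ((hA k _).trans ?_) ((A.le_opNorm _).trans ?_))
  · rw [mul_assoc]
    exact mul_le_mul_of_nonneg_left (B.le_opNorm x) hK
  · rw [mul_assoc]
    exact mul_le_mul_of_nonneg_left (hB k x) (norm_nonneg _)

/-- By the Leibniz rule there are n terms, each with a single commutator between contractions.
Linear growth in n is what makes the product formula for e^{-itH} converge with a finite bound. -/
theorem pow (hA : CommutatorBound A K) (h1 : ‖A‖ ≤ 1) (n : ℕ) :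
    CommutatorBound (A ^ n) (n * K) := by
  have hK : 0 ≤ K := by
    have := (norm_nonneg _).trans (hA 0 (lp.single 2 0 1))
    simpa [lp.norm_single] using this
  induction n with
  | zero => simpa using one
  | succ n ih =>
    intro k x
    rw [pow_succ]
    refine (ih.mul hA k x).trans (mul_le_mul_of_nonneg_right ?_ (norm_nonneg _))
    have h2 : ‖A ^ n‖ ≤ 1 := by
      refine ContinuousLinearMap.opNorm_le_bound _ zero_le_one fun y => ?_
      clear ih
      induction n with
      | zero => simp
      | succ n ih =>
        rw [pow_succ', mul_apply_eq_comp]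
        refine (A.le_opNorm _).trans ?_
        exact mul_le_mul h1 (by simpa using ih) (norm_nonneg _) zero_le_one |>.trans (by simp)
    have h3 : n * K * ‖A‖ ≤ n * K * 1 := mul_le_mul_of_nonneg_left h1 (by positivity)
    have h4 : ‖A ^ n‖ * K ≤ 1 * K := mul_le_mul_of_nonneg_right h2 hK
    push_cast
    linarith

theorem of_tendsto {F : ℕ → L2 d →L[ℂ] L2 d} (hF : ∀ᶠ j in atTop, CommutatorBound (F j) K)
    (h : ∀ x, Tendsto (fun j => F j x) atTop (𝓝 (A x))) : CommutatorBound A K := fun k x =>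
  le_of_tendsto ((((cutoff d k).continuous.tendsto _).comp (h x)).sub (h _)).norm
    (hF.mono fun _ hj => hj k x)

end CommutatorBound

end Lattice

/-! ### Graphs of self-adjoint operators. -/

section SelfAdjoint

variable {E : Type*} [NormedAddCommGroup E] [InnerProductSpace ℂ E] [CompleteSpace E]
  {H : E →ₗ.[ℂ] E}

/-- This is H = H* at the level of graphs, and the way in which membership in D(H) is verified
below. -/
theorem mem_graph_iff_of_isSelfAdjoint (hH : IsSelfAdjoint H) (y y' : E) :
    (y, y') ∈ H.graph ↔ ∀ x x', (x, x') ∈ H.graph → ⟪x', y⟫_ℂ = ⟪x, y'⟫_ℂ := by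
  have h := Submodule.mem_adjoint_iff H.graph (y, y')
  rw [← LinearPMap.adjoint_graph_eq_graph_adjoint hH.dense_domain,
    LinearPMap.isSelfAdjoint_def.1 hH] at h
  simpa only [sub_eq_zero] using h

theorem inner_symm_of_isSelfAdjoint (hH : IsSelfAdjoint H) {x x' y y' : E}
    (hx : (x, x') ∈ H.graph) (hy : (y, y') ∈ H.graph) : ⟪x', y⟫_ℂ = ⟪x, y'⟫_ℂ :=
  (mem_graph_iff_of_isSelfAdjoint hH y y').1 hy x x' hx

theorem eq_zero_of_mem_graph_smul (hH : IsSelfAdjoint H) {z : ℂ} (hz : z.im ≠ 0) {x : E}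
    (hx : (x, z • x) ∈ H.graph) : x = 0 := by
  have h := inner_symm_of_isSelfAdjoint hH hx hx
  rw [inner_smul_left, inner_smul_right] at h
  by_contra h0
  have h1 : ⟪x, x⟫_ℂ ≠ 0 := inner_self_ne_zero.2 h0
  have h2 := congrArg Complex.im (mul_right_cancel₀ h1 h)
  rw [Complex.conj_im] at h2
  apply hz
  linarith

/-- Lets identities that are continuous in the pair (x, Hx) pass from the core to all of D(H). -/
theorem closure_graph_of_hasCore (hH : IsSelfAdjoint H) {S : Submodule ℂ E} (hS : H.HasCore S)
    {x x' : E} (hx : (x, x') ∈ H.graph) :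
    (x, x') ∈ closure {p : E × E | p.1 ∈ S ∧ p ∈ H.graph} := by
  have hle : H.domRestrict S ≤ H := LinearPMap.domRestrict_le
  have hc : (H.domRestrict S).IsClosable := hH.isClosed.isClosable.leIsClosable hle
  have h := hc.graph_closure_eq_closure_graph
  rw [hS.closure_eq] at h
  rw [← h, ← SetLike.mem_coe, Submodule.topologicalClosure_coe] at hx
  refine closure_mono (fun p hp => ?_) hx
  refine ⟨?_, LinearPMap.le_graph_of_le hle hp⟩
  obtain ⟨y, hy, -⟩ := (LinearPMap.mem_graph_iff _).1 hp
  rw [← hy]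
  exact y.2.1

end SelfAdjoint

/-! ### Commutators of the cutoffs with H, its resolvents and its unitary group. -/

section Commutator

variable {d : ℕ} {H : L2 d →ₗ.[ℂ] L2 d} {C : L2 d →L[ℂ] L2 d}

/-- The commutator form `⟨x, [Q, H] y⟩` on `D(Q) ∩ D(H)` is that of `C`. -/
def IsCommutator (H : L2 d →ₗ.[ℂ] L2 d) (C : L2 d →L[ℂ] L2 d) : Prop :=
  ∀ (x y : (weightOp d).domain) (x' y' : L2 d),
    ((x : L2 d), x') ∈ H.graph → ((y : L2 d), y') ∈ H.graph →
      ⟪(x : L2 d), C y⟫_ℂ = ⟪weightOp d x, y'⟫_ℂ - ⟪x', weightOp d y⟫_ℂ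

/-- Substitute x = S_k x + (k+1)⁻¹ Q_k x, and likewise for y, inside Hx and Hy. The terms containing
H Q_k x and H Q_k y cancel by symmetry of H; what remains is the form of C at S_k x, S_k y, because
Q S_k = Q_k. Finite support guarantees that all these vectors lie in D(H). -/
theorem inner_cutoff_sub_of_finitelySupported (hH : IsSelfAdjoint H)
    (hcore : H.HasCore (finitelySupported d)) (hC : IsCommutator H C) (k : ℕ) {x x' y y' : L2 d}
    (hx : x ∈ finitelySupported d) (hy : y ∈ finitelySupported d)
    (hx' : (x, x') ∈ H.graph) (hy' : (y, y') ∈ H.graph) :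
    ⟪cutoff d k x, y'⟫_ℂ - ⟪x', cutoff d k y⟫_ℂ = ⟪smoothing d k x, C (smoothing d k y)⟫_ℂ := by
  have hgr : ∀ w, w ∈ finitelySupported d → ∃ w', (w, w') ∈ H.graph := fun w hw =>
    ⟨H ⟨w, hcore.le_domain hw⟩, H.mem_graph ⟨w, _⟩⟩
  have hdecomp : ∀ w w', w ∈ finitelySupported d → (w, w') ∈ H.graph → ∃ a b,
      (smoothing d k w, a) ∈ H.graph ∧ (cutoff d k w, b) ∈ H.graph ∧
        w' = a + ((k : ℂ) + 1)⁻¹ • b := by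
    intro w w' hw hw'
    obtain ⟨a, ha⟩ := hgr _ (diagOp_mem_finitelySupported (ha := smoothing_aux k) hw)
    obtain ⟨b, hb⟩ := hgr _ (diagOp_mem_finitelySupported (ha := cutoff_aux k) hw)
    refine ⟨a, b, ha, hb, ?_⟩
    have := H.graph.add_mem ha (H.graph.smul_mem ((k : ℂ) + 1)⁻¹ hb)
    rw [Prod.smul_mk, Prod.mk_add_mk] at this
    refine LinearPMap.mem_graph_snd_inj' _ hw' this ?_
    exact smoothing_add_cutoff k w
  obtain ⟨a, b, ha, hb, rfl⟩ := hdecomp x x' hx hx'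
  obtain ⟨a', b', ha', hb', rfl⟩ := hdecomp y y' hy hy'
  have hSx : smoothing d k x ∈ (weightOp d).domain :=
    finitelySupported_le (diagOp_mem_finitelySupported hx)
  have hSy : smoothing d k y ∈ (weightOp d).domain :=
    finitelySupported_le (diagOp_mem_finitelySupported hy)
  have h := hC ⟨_, hSx⟩ ⟨_, hSy⟩ a a' ha ha'
  rw [weightOp_eq_cutoff k x ⟨_, hSx⟩ rfl, weightOp_eq_cutoff k y ⟨_, hSy⟩ rfl] at h
  have hsymm := inner_symm_of_isSelfAdjoint hH hb hb'
  have hreal : (starRingEnd ℂ) ((k : ℂ) + 1)⁻¹ = ((k : ℂ) + 1)⁻¹ := by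
    simp
  rw [inner_add_right, inner_add_left, inner_smul_left, inner_smul_right, hreal, hsymm]
  simp only at h
  rw [h]
  ring

theorem inner_cutoff_sub (hH : IsSelfAdjoint H) (hcore : H.HasCore (finitelySupported d))
    (hC : IsCommutator H C) (k : ℕ) {x x' y y' : L2 d}
    (hx : (x, x') ∈ H.graph) (hy : (y, y') ∈ H.graph) :
    ⟪cutoff d k x, y'⟫_ℂ - ⟪x', cutoff d k y⟫_ℂ = ⟪smoothing d k x, C (smoothing d k y)⟫_ℂ := by
  let s : Set (L2 d × L2 d) := {p | p.1 ∈ finitelySupported d ∧ p ∈ H.graph}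
  have hmem : (((x, x'), (y, y')) : (L2 d × L2 d) × (L2 d × L2 d)) ∈ closure (s ×ˢ s) := by
    rw [closure_prod_eq]
    exact ⟨closure_graph_of_hasCore hH hcore hx, closure_graph_of_hasCore hH hcore hy⟩
  -- Only bounded operators act on x, Hx, y, Hy here, so the identity is closed in the graph
  -- topology.
  have hcl : IsClosed {p : (L2 d × L2 d) × (L2 d × L2 d) |
      ⟪cutoff d k p.1.1, p.2.2⟫_ℂ - ⟪p.1.2, cutoff d k p.2.1⟫_ℂ =
        ⟪smoothing d k p.1.1, C (smoothing d k p.2.1)⟫_ℂ} :=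
    isClosed_eq (by fun_prop) (by fun_prop)
  refine closure_minimal ?_ hcl hmem
  rintro ⟨⟨a, a'⟩, ⟨b, b'⟩⟩ ⟨⟨ha, ha'⟩, ⟨hb, hb'⟩⟩
  exact inner_cutoff_sub_of_finitelySupported hH hcore hC k ha hb ha' hb'

/-- The cutoffs of `Q` preserve the domain of `H`, with `[Q_k, H] = S_k C S_k`. -/
theorem cutoff_mem_graph (hH : IsSelfAdjoint H) (hcore : H.HasCore (finitelySupported d))
    (hC : IsCommutator H C) (k : ℕ) {y y' : L2 d} (hy : (y, y') ∈ H.graph) :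
    (cutoff d k y, cutoff d k y' - smoothing d k (C (smoothing d k y))) ∈ H.graph := by
  -- The form identity shows Q_k y ∈ D(H*) = D(H).
  rw [mem_graph_iff_of_isSelfAdjoint hH]
  intro x x' hx
  rw [inner_sub_right, ← inner_cutoff_left k x, ← inner_smoothing_left,
    ← inner_cutoff_sub hH hcore hC k hx hy]
  ring

variable {Φ : (ℝ → ℂ) → (L2 d →L[ℂ] L2 d)}

theorem bddBorel_resolvent {z : ℂ} (hz : z.im ≠ 0) :
    Measurable (fun s : ℝ => ((s : ℂ) - z)⁻¹) ∧ ∀ s : ℝ, ‖((s : ℂ) - z)⁻¹‖ ≤ |z.im|⁻¹ := by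
  refine ⟨by fun_prop, fun s => ?_⟩
  rw [norm_inv]
  refine inv_anti₀ (abs_pos.2 hz) ?_
  have := Complex.abs_im_le_norm ((s : ℂ) - z)
  simpa using this

/-- `[Q_k, (H - z)⁻¹] = -(H - z)⁻¹ S_k C S_k (H - z)⁻¹`. -/
theorem commutatorBound_resolvent (hH : IsSelfAdjoint H)
    (hcore : H.HasCore (finitelySupported d)) (hC : IsCommutator H C)
    (hΦ : IsBorelCalculus H Φ) {z : ℂ} (hz : z.im ≠ 0) :
    CommutatorBound (Φ fun s => ((s : ℂ) - z)⁻¹) (|z.im|⁻¹ ^ 2 * ‖C‖) := by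
  intro k v
  set R := Φ fun s => ((s : ℂ) - z)⁻¹ with hR
  have hRn : ‖R‖ ≤ |z.im|⁻¹ :=
    hΦ.norm_map_le (bddBorel_resolvent hz).1 (bddBorel_resolvent hz).2
  have hSn : ∀ w, ‖smoothing d k w‖ ≤ ‖w‖ := fun w => by
    simpa using (smoothing d k).le_of_opNorm_le (norm_smoothing_le k) w
  have hv := cutoff_mem_graph hH hcore hC k (hΦ.resolvent z hz v)
  rw [← hR] at hv
  set c := smoothing d k (C (smoothing d k (R v))) with hc
  have hk := hΦ.resolvent z hz (cutoff d k v - c)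
  rw [← hR] at hk
  -- Both vectors solve (H - z)w = Q_k v - c, and H has no non-real eigenvalue.
  have h0 : cutoff d k (R v) - R (cutoff d k v - c) = 0 := by
    refine eq_zero_of_mem_graph_smul hH hz ?_
    convert H.graph.sub_mem hv hk using 1
    rw [Prod.mk_sub_mk, map_add, _root_.map_smul, smul_sub]
    congr 1
    abel
  have h1 : cutoff d k (R v) - R (cutoff d k v) = -R c := by
    rw [map_sub] at h0
    rw [← sub_eq_zero, ← h0]
    abel
  rw [h1, norm_neg]
  have h2 : ‖c‖ ≤ ‖C‖ * (|z.im|⁻¹ * ‖v‖) := by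
    refine (hSn _).trans ((C.le_opNorm _).trans ?_)
    gcongr
    exact (hSn _).trans (R.le_of_opNorm_le hRn v)
  calc ‖R c‖ ≤ |z.im|⁻¹ * ‖c‖ := R.le_of_opNorm_le hRn c
    _ ≤ |z.im|⁻¹ * (‖C‖ * (|z.im|⁻¹ * ‖v‖)) := by gcongr
    _ = |z.im|⁻¹ ^ 2 * ‖C‖ * ‖v‖ := by ring

/-! ### The unitary group -/

/-- The phase `s ↦ e^{-its}`. -/
def phase (t : ℝ) (s : ℝ) : ℂ := Complex.exp (-Complex.I * t * s)

theorem norm_phase (t s : ℝ) : ‖phase t s‖ = 1 := by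
  rw [phase, show -Complex.I * t * s = ((-(t * s) : ℝ) : ℂ) * Complex.I by push_cast; ring,
    Complex.norm_exp_ofReal_mul_I]

theorem bddBorel_phase (t : ℝ) : BddBorel (phase t) :=
  ⟨by unfold phase; fun_prop, 1, fun s => (norm_phase t s).le⟩

theorem phase_add (t t' s : ℝ) : phase (t + t') s = phase t s * phase t' s := by
  rw [phase, phase, phase, ← Complex.exp_add]
  congr 1
  push_cast
  ring

theorem phase_zero (s : ℝ) : phase 0 s = 1 := by simp [phase]

theorem commutatorBound_phase (hH : IsSelfAdjoint H)
    (hcore : H.HasCore (finitelySupported d)) (hC : IsCommutator H C)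
    (hΦ : IsBorelCalculus H Φ) (t : ℝ) : CommutatorBound (Φ (phase t)) (|t| * ‖C‖) := by
  rcases eq_or_ne t 0 with rfl | ht
  · have : phase 0 = fun _ => 1 := funext phase_zero
    rw [this, hΦ.map_const, one_smul]
    simpa using CommutatorBound.one
  have hne : ∀ (j : ℕ) (s : ℝ), (1 : ℂ) + Complex.I * t * s / j ≠ 0 := fun j s h => by
    have := congrArg Complex.re h
    rw [show Complex.I * t * s / j = Complex.I * ((t * s / j : ℝ) : ℂ) by push_cast; ring] at this
    simp at this
  have hone : ∀ (j : ℕ) (s : ℝ), 1 ≤ ‖(1 : ℂ) + Complex.I * t * s / j‖ := fun j s => by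
    refine le_trans ?_ (Complex.abs_re_le_norm _)
    rw [show Complex.I * t * s / j = Complex.I * ((t * s / j : ℝ) : ℂ) by push_cast; ring]
    simp
  -- Here r_j^j → e^{-its}, and r_j(s) = -i(j/t)(s - ij/t)⁻¹ for j ≥ 1. The resolvent bound gives
  -- r_j(H) the commutator bound (j/|t|)(|t|/j)²‖C‖ = |t|‖C‖/j, so the j-th power has bound |t|‖C‖
  -- independently of j.
  let r : ℕ → ℝ → ℂ := fun j s => (1 + Complex.I * t * s / j)⁻¹
  have hrm : ∀ j, Measurable (r j) := fun j => by fun_prop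
  have hr1 : ∀ j s, ‖r j s‖ ≤ 1 := fun j s => by
    rw [norm_inv]
    exact inv_le_one_of_one_le₀ (hone j s)
  have hrb : ∀ j, BddBorel (r j) := fun j => ⟨hrm j, 1, hr1 j⟩
  refine CommutatorBound.of_tendsto (F := fun j => Φ (fun s => r j s ^ j)) ?_ fun x => ?_
  · filter_upwards [eventually_ge_atTop 1] with j hj
    have hj0 : (j : ℝ) ≠ 0 := by positivity
    have hjc : (j : ℂ) ≠ 0 := by exact_mod_cast hj0
    have htc : (t : ℂ) ≠ 0 := by exact_mod_cast ht
    have hz : (Complex.I * ((j / t : ℝ) : ℂ)).im ≠ 0 := by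
      simp only [Complex.mul_im, Complex.I_re, Complex.I_im, Complex.ofReal_re, Complex.ofReal_im]
      simp [ht, hj0]
    have hres := (commutatorBound_resolvent hH hcore hC hΦ hz).smul (-Complex.I * (j / t : ℝ))
    rw [← hΦ.map_smul ⟨(bddBorel_resolvent hz).1, _, (bddBorel_resolvent hz).2⟩] at hres
    have hrw : (fun s : ℝ => -Complex.I * ((j / t : ℝ) : ℂ) *
        ((s : ℂ) - Complex.I * ((j / t : ℝ) : ℂ))⁻¹) = r j := by
      ext s
      have h1 := hne j s
      have h2 : (s : ℂ) - Complex.I * ((j / t : ℝ) : ℂ) =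
          -Complex.I * ((j / t : ℝ) : ℂ) * (1 + Complex.I * t * s / j) := by
        push_cast
        field_simp
        linear_combination ((s : ℂ) * t) * Complex.I_sq
      have h3 : -Complex.I * ((j / t : ℝ) : ℂ) ≠ 0 := by
        push_cast
        simp [hjc, htc]
      rw [h2, mul_inv, ← mul_assoc, mul_inv_cancel₀ h3, one_mul]
    rw [hrw] at hres
    rw [hΦ.map_pow (hrb j)]
    convert hres.pow (hΦ.norm_map_le (hrm j) (hr1 j)) j using 1
    have him : (Complex.I * ((j / t : ℝ) : ℂ)).im = j / t := by simp
    have hnm : ‖-Complex.I * ((j / t : ℝ) : ℂ)‖ = j / |t| := by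
      rw [norm_mul, norm_neg, Complex.norm_I, one_mul, Complex.norm_real, Real.norm_eq_abs,
        abs_div, Nat.abs_cast]
    rw [him, hnm, abs_div, Nat.abs_cast]
    have : |t| ≠ 0 := abs_ne_zero.2 ht
    field_simp
  · refine hΦ.tendsto _ _ 1 (fun j => (hrm j).pow_const j) (fun j s => ?_) (fun s => ?_) x
    · rw [norm_pow]
      exact pow_le_one₀ (norm_nonneg _) (hr1 j s)
    · have h := (Complex.tendsto_one_add_div_pow_exp (Complex.I * t * s)).inv₀
        (Complex.exp_ne_zero _)
      rw [← Complex.exp_neg] at h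
      have he : -(Complex.I * t * s) = -Complex.I * t * s := by ring
      rw [he] at h
      simpa only [r, inv_pow, phase] using h

theorem norm_phase_apply (hΦ : IsBorelCalculus H Φ) (t : ℝ) (v : L2 d) :
    ‖Φ (phase t) v‖ = ‖v‖ := by
  refine le_antisymm ?_ ?_
  · simpa using hΦ.norm_apply_le (bddBorel_phase t).1 (fun s => (norm_phase t s).le) v
  · have h := hΦ.norm_apply_le (bddBorel_phase (-t)).1 (fun s => (norm_phase (-t) s).le)
      (Φ (phase t) v)
    rw [hΦ.mul_apply (bddBorel_phase _) (bddBorel_phase _)] at h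
    simpa only [← phase_add, neg_add_cancel, phase_zero, hΦ.map_const, one_smul, one_apply_eq_self,
      one_mul] using h

end Commutator

/-! ### The scalar Cayley transform. -/

section Cayley

/-- The Cayley transform `s ↦ (s - i) / (s + i)`. -/
def cayley (s : ℝ) : ℂ := (s - Complex.I) / (s + Complex.I)

theorem ofReal_sub_ne_zero (s : ℝ) {z : ℂ} (hz : z.im ≠ 0) : (s : ℂ) - z ≠ 0 := fun h => by
  have := congrArg Complex.im h
  simp at this
  exact hz this

theorem ofReal_add_I_ne_zero (s : ℝ) : (s : ℂ) + Complex.I ≠ 0 := by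
  simpa using ofReal_sub_ne_zero s (z := -Complex.I) (by simp)

theorem norm_cayley (s : ℝ) : ‖cayley s‖ = 1 := by
  have h : (s : ℂ) - Complex.I = (starRingEnd ℂ) (s + Complex.I) := by simp [sub_eq_add_neg]
  rw [cayley, norm_div, h, Complex.norm_conj,
    div_self (norm_ne_zero_iff.2 (ofReal_add_I_ne_zero s))]

theorem cayley_eq (s : ℝ) : cayley s = 1 + (-2 * Complex.I) * ((s : ℂ) - -Complex.I)⁻¹ := by
  have h := ofReal_add_I_ne_zero s
  rw [cayley, sub_neg_eq_add]
  field_simp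
  ring

theorem star_cayley_eq (s : ℝ) :
    star (cayley s) = 1 + (2 * Complex.I) * ((s : ℂ) - Complex.I)⁻¹ := by
  rw [cayley_eq]
  simp [sub_eq_add_neg]

theorem continuous_cayley : Continuous cayley := by
  unfold cayley
  exact Continuous.div (by fun_prop) (by fun_prop) ofReal_add_I_ne_zero

theorem cayley_injective : Function.Injective cayley := by
  intro s t h
  rw [cayley_eq, cayley_eq] at h
  have h1 : (-2 * Complex.I) ≠ 0 := by simp
  simpa using inv_injective (mul_left_cancel₀ h1 (add_left_cancel h))

/-- The Cayley transform as a map into the unit circle. -/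
def cayleyCircle (s : ℝ) : Metric.sphere (0 : ℂ) 1 := ⟨cayley s, by simp [norm_cayley]⟩

end Cayley

/-! ### Domain of H and continuous approximation of spectral projections. -/

section Graph

variable {E : Type*} [NormedAddCommGroup E] [InnerProductSpace ℂ E] [CompleteSpace E]
  {H : E →ₗ.[ℂ] E} {Φ : (ℝ → ℂ) → (E →L[ℂ] E)}

/-- From f = (s - i)⁻¹(g - if), the vector f(H)v is in the range of the resolvent at i. -/
theorem IsBorelCalculus.mem_graph (hΦ : IsBorelCalculus H Φ) {f g : ℝ → ℂ} (hf : BddBorel f)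
    (hg : BddBorel g) (hfg : ∀ s : ℝ, g s = s * f s) (v : E) : (Φ f v, Φ g v) ∈ H.graph := by
  have hI : Complex.I.im ≠ 0 := by simp
  have hr : BddBorel fun s : ℝ => ((s : ℂ) - Complex.I)⁻¹ :=
    ⟨(bddBorel_resolvent hI).1, _, (bddBorel_resolvent hI).2⟩
  have hh : BddBorel fun s => g s - Complex.I * f s := by
    simpa only [neg_mul, ← sub_eq_add_neg] using hg.add ((BddBorel.const (-Complex.I)).mul hf)
  have h := hΦ.resolvent Complex.I hI (Φ (fun s => g s - Complex.I * f s) v)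
  rw [hΦ.mul_apply hr hh, hΦ.map_sub hg ((BddBorel.const _).mul hf), hΦ.map_smul hf] at h
  have he : (fun s : ℝ => ((s : ℂ) - Complex.I)⁻¹ * (g s - Complex.I * f s)) = f := by
    ext s
    rw [hfg, ← sub_mul, inv_mul_cancel_left₀ (ofReal_sub_ne_zero s hI)]
  rw [he] at h
  simpa using h

/-- Inner regularity of the spectral measure of u. -/
theorem IsBorelCalculus.exists_isCompact_norm_lt (hΦ : IsBorelCalculus H Φ) {I : Set ℝ}
    (hI : MeasurableSet I) (u : E) {δ : ℝ} (hδ : 0 < δ) : ∃ K, IsCompact K ∧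
      ‖Φ (K.indicator 1) u - Φ (I.indicator 1) u‖ < δ := by
  obtain ⟨μ, hμ, hμI⟩ := hΦ.exists_spectralMeasure u
  obtain ⟨K, hKI, hK, hlt⟩ := hI.exists_isCompact_sdiff_lt (measure_ne_top μ I)
    (ε := ENNReal.ofReal (δ ^ 2)) (by simp [hδ.ne'])
  refine ⟨K, hK, ?_⟩
  rw [hμI _ (hI.diff hK.measurableSet), ENNReal.ofReal_lt_ofReal_iff (by positivity)] at hlt
  rw [norm_sub_rev, ← sub_apply, ← hΦ.map_sub (BddBorel.indicator hI)
    (BddBorel.indicator hK.measurableSet)]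
  have : (fun s => (I.indicator 1 s : ℂ) - K.indicator 1 s) = (I \ K).indicator 1 := by
    ext s
    by_cases h1 : s ∈ K
    · simp [h1, hKI h1]
    · by_cases h2 : s ∈ I <;> simp [h1, h2]
  rw [this]
  exact lt_of_pow_lt_pow_left₀ 2 hδ.le hlt

/-- Continuity on the whole circle is wanted so that Stone–Weierstrass applies. The Cayley image of
a compact K is closed, so thickened indicators of it converge pointwise to its indicator, and
injectivity of the transform pulls this back to K. -/
theorem IsBorelCalculus.exists_continuousMap_norm_lt (hΦ : IsBorelCalculus H Φ) {I : Set ℝ}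
    (hI : MeasurableSet I) (u : E) {δ : ℝ} (hδ : 0 < δ) : ∃ h : C(Metric.sphere (0 : ℂ) 1, ℂ),
      ‖h‖ ≤ 1 ∧ ‖Φ (fun s => h (cayleyCircle s)) u - Φ (I.indicator 1) u‖ < δ := by
  obtain ⟨K, hK, hKI⟩ := hΦ.exists_isCompact_norm_lt hI u (half_pos hδ)
  have hKc : IsClosed (cayley '' K) := (hK.image continuous_cayley).isClosed
  have hpos : ∀ n : ℕ, (0 : ℝ) < 1 / (n + 1) := fun n => Nat.one_div_pos_of_nat
  have hti := thickenedIndicator_tendsto_indicator_closure hpos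
    tendsto_one_div_add_atTop_nhds_zero_nat (cayley '' K)
  rw [tendsto_pi_nhds, hKc.closure_eq] at hti
  let h : ℕ → C(Metric.sphere (0 : ℂ) 1, ℂ) := fun n =>
    ⟨fun w => ((thickenedIndicator (hpos n) (cayley '' K) (w : ℂ) : ℝ) : ℂ), by fun_prop⟩
  have hle : ∀ n w, ‖h n w‖ ≤ 1 := fun n w => by
    change ‖((thickenedIndicator (hpos n) (cayley '' K) (w : ℂ) : ℝ) : ℂ)‖ ≤ 1
    rw [Complex.norm_real, Real.norm_of_nonneg (NNReal.coe_nonneg _)]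
    exact_mod_cast thickenedIndicator_le_one _ _ _
  have hcc : Continuous cayleyCircle := continuous_cayley.subtype_mk _
  have hlim : Tendsto (fun n => Φ (fun s => h n (cayleyCircle s)) u) atTop
      (𝓝 (Φ (K.indicator 1) u)) := by
    refine hΦ.tendsto _ _ 1 (fun n => ((h n).continuous.comp hcc).measurable)
      (fun n s => hle n _) (fun s => ?_) u
    have h1 := (Complex.continuous_ofReal.comp NNReal.continuous_coe).tendsto _ |>.comp
      (hti (cayley s))
    have h2 : (K.indicator 1 s : ℂ) = (Complex.ofReal ∘ NNReal.toReal)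
        ((cayley '' K).indicator (fun _ => 1) (cayley s)) := by
      by_cases hs : s ∈ K
      · have : cayley s ∈ cayley '' K := ⟨s, hs, rfl⟩
        simp [hs, this]
      · have : cayley s ∉ cayley '' K := fun ⟨t, ht, hts⟩ => hs (cayley_injective hts ▸ ht)
        rw [Set.indicator_of_notMem hs, Set.indicator_of_notMem this]
        simp
    rw [h2]
    exact h1
  obtain ⟨n, hn⟩ := ((tendsto_iff_norm_sub_tendsto_zero.1 hlim).eventually_lt_const
    (half_pos hδ)).exists
  refine ⟨h n, (ContinuousMap.norm_le _ zero_le_one).2 (hle n), ?_⟩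
  calc _ ≤ _ := norm_sub_le_norm_sub_add_norm_sub _ (Φ (K.indicator 1) u) _
    _ < δ := by linarith

end Graph

/-! ### Functions of H with bounded commutator with Q. -/

section Approximation

variable {d : ℕ} {H : L2 d →ₗ.[ℂ] L2 d} {Φ : (ℝ → ℂ) → (L2 d →L[ℂ] L2 d)}

variable (Φ) in
/-- The bounded Borel functions `f` for which `[Q, f(H)]` is bounded. -/
def HasBoundedSymbol (f : ℝ → ℂ) : Prop :=
  BddBorel f ∧ ∃ M, CommutatorBound (Φ f) M

namespace HasBoundedSymbol

variable {f g : ℝ → ℂ}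

theorem const (hΦ : IsBorelCalculus H Φ) (a : ℂ) : HasBoundedSymbol Φ fun _ => a :=
  ⟨BddBorel.const a, _, by rw [hΦ.map_const]; exact CommutatorBound.one.smul a⟩

theorem add (hΦ : IsBorelCalculus H Φ) (hf : HasBoundedSymbol Φ f) (hg : HasBoundedSymbol Φ g) :
    HasBoundedSymbol Φ fun s => f s + g s := by
  obtain ⟨hf, K, hK⟩ := hf
  obtain ⟨hg, L, hL⟩ := hg
  exact ⟨hf.add hg, _, by rw [hΦ.map_add _ _ hf hg]; exact hK.add hL⟩

theorem mul (hΦ : IsBorelCalculus H Φ) (hf : HasBoundedSymbol Φ f) (hg : HasBoundedSymbol Φ g) :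
    HasBoundedSymbol Φ fun s => f s * g s := by
  obtain ⟨hf, K, hK⟩ := hf
  obtain ⟨hg, L, hL⟩ := hg
  exact ⟨hf.mul hg, _, by rw [hΦ.map_mul _ _ hf hg]; exact hK.mul hL⟩

variable {C : L2 d →L[ℂ] L2 d} (hH : IsSelfAdjoint H)
  (hcore : H.HasCore (finitelySupported d)) (hC : IsCommutator H C) (hΦ : IsBorelCalculus H Φ)
include hH hcore hC hΦ

theorem resolvent {z : ℂ} (hz : z.im ≠ 0) : HasBoundedSymbol Φ fun s : ℝ => ((s : ℂ) - z)⁻¹ :=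
  ⟨⟨(bddBorel_resolvent hz).1, _, (bddBorel_resolvent hz).2⟩, _,
    commutatorBound_resolvent hH hcore hC hΦ hz⟩

theorem cayley_mem : HasBoundedSymbol Φ cayley := by
  have := (const hΦ 1).add hΦ ((const hΦ (-2 * Complex.I)).mul hΦ
    (resolvent hH hcore hC hΦ (z := -Complex.I) (by simp)))
  simpa only [← cayley_eq] using this

theorem star_cayley_mem : HasBoundedSymbol Φ fun s => star (cayley s) := by
  have := (const hΦ 1).add hΦ ((const hΦ (2 * Complex.I)).mul hΦ
    (resolvent hH hcore hC hΦ (z := Complex.I) (by simp)))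
  simpa only [← star_cayley_eq] using this

theorem exists_norm_sub_lt (h : C(Metric.sphere (0 : ℂ) 1, ℂ)) {ε : ℝ} (hε : 0 < ε) :
    ∃ f, HasBoundedSymbol Φ f ∧ ∀ s, ‖f s - h (cayleyCircle s)‖ ≤ ε := by
  -- Stone–Weierstrass: polynomials in w and its conjugate are uniformly dense on the circle.
  have hmem : h ∈ StarAlgebra.elemental ℂ
      (ContinuousMap.restrict (Metric.sphere (0 : ℂ) 1) (.id ℂ)) := by
    rw [ContinuousMap.elemental_id_eq_top]; trivial
  rw [StarAlgebra.elemental, ← SetLike.mem_coe, StarSubalgebra.topologicalClosure_coe] at hmem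
  obtain ⟨p, hp, hph⟩ := Metric.mem_closure_iff.1 hmem ε hε
  refine ⟨fun s => p (cayleyCircle s), ?_, fun s => ?_⟩
  · clear hph
    -- Carrying the conjugate through the induction avoids a separate argument for adjoints.
    have hboth : HasBoundedSymbol Φ (fun s => p (cayleyCircle s)) ∧
        HasBoundedSymbol Φ (fun s => star (p (cayleyCircle s))) := by
      refine StarAlgebra.adjoin_induction (p := fun p _ =>
        HasBoundedSymbol Φ (fun s => p (cayleyCircle s)) ∧
          HasBoundedSymbol Φ (fun s => star (p (cayleyCircle s)))) ?_ ?_ ?_ ?_ ?_ hp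
      · rintro _ rfl
        exact ⟨cayley_mem hH hcore hC hΦ, star_cayley_mem hH hcore hC hΦ⟩
      · exact fun r => ⟨const hΦ r, const hΦ (star r)⟩
      · exact fun x y _ _ hx hy => ⟨hx.1.add hΦ hy.1, by
          simpa only [ContinuousMap.add_apply, star_add] using hx.2.add hΦ hy.2⟩
      · exact fun x y _ _ hx hy => ⟨hx.1.mul hΦ hy.1, by
          simpa only [ContinuousMap.mul_apply, star_mul'] using hx.2.mul hΦ hy.2⟩
      · exact fun x _ hx => ⟨hx.2, by simpa only [ContinuousMap.star_apply, star_star] using hx.1⟩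
    exact hboth.1
  · rw [← dist_eq_norm, dist_comm]
    exact (ContinuousMap.dist_apply_le_dist _).trans hph.le

/-- Spectral projections are strong limits of uniformly bounded functions of `H` which have a
bounded commutator with `Q`. -/
theorem exists_approx {I : Set ℝ} (hI : MeasurableSet I) (u : L2 d) {δ : ℝ} (hδ : 0 < δ) :
    ∃ f, HasBoundedSymbol Φ f ∧ (∀ s, ‖f s‖ ≤ 2) ∧ ‖Φ f u - Φ (I.indicator 1) u‖ < δ := by
  obtain ⟨h, h1, hhI⟩ := hΦ.exists_continuousMap_norm_lt hI u (half_pos hδ)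
  -- ε ≤ 1 gives |f| ≤ 2; the other bound gives ε‖u‖ ≤ δ/2.
  set ε := min 1 (δ / (2 * (‖u‖ + 1))) with hε
  have hε0 : 0 < ε := by positivity
  obtain ⟨f, hf, hfh⟩ := exists_norm_sub_lt hH hcore hC hΦ h hε0
  have hcc : Continuous cayleyCircle := continuous_cayley.subtype_mk _
  have hhb : ∀ s, ‖h (cayleyCircle s)‖ ≤ 1 := fun s => (h.norm_coe_le_norm _).trans h1
  have hhB : BddBorel fun s => h (cayleyCircle s) :=
    ⟨(h.continuous.comp hcc).measurable, 1, hhb⟩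
  refine ⟨f, hf, fun s => ?_, ?_⟩
  · have h2 := norm_sub_norm_le (f s) (h (cayleyCircle s))
    have h3 := (hfh s).trans (min_le_left _ _)
    linarith [hhb s]
  · have h2 : ‖Φ f u - Φ (fun s => h (cayleyCircle s)) u‖ ≤ ε * ‖u‖ := by
      rw [← sub_apply, ← hΦ.map_sub hf.1 hhB]
      exact hΦ.norm_apply_le (hf.1.1.sub hhB.1) hfh u
    have h3 : ε * ‖u‖ ≤ δ / 2 := by
      refine (mul_le_mul_of_nonneg_right (min_le_right _ _) (norm_nonneg u)).trans ?_
      rw [div_mul_eq_mul_div, div_le_div_iff₀ (by positivity) (by positivity)]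
      nlinarith [norm_nonneg u]
    calc _ ≤ _ := norm_sub_le_norm_sub_add_norm_sub _ (Φ (fun s => h (cayleyCircle s)) u) _
      _ < δ := by linarith

/-- A vector of `𝓗¹` can be regularised so that three consecutive powers of `H` remain in the
class of functions of `H` having a bounded commutator with `Q`. -/
theorem exists_approx_smooth {I : Set ℝ} (hI : MeasurableSet I) (u : L2 d) {δ : ℝ} (hδ : 0 < δ) :
    ∃ f₀ f₁ f₂, HasBoundedSymbol Φ f₀ ∧ HasBoundedSymbol Φ f₁ ∧ HasBoundedSymbol Φ f₂ ∧
      (∀ s : ℝ, f₁ s = s * f₀ s) ∧ (∀ s : ℝ, f₂ s = s * f₁ s) ∧ (∀ s, ‖f₀ s‖ ≤ 2) ∧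
      ‖Φ f₀ u - Φ (I.indicator 1) u‖ < δ := by
  obtain ⟨f, hf, hf2, hfI⟩ := exists_approx hH hcore hC hΦ hI u (half_pos hδ)
  let m : ℕ → ℂ := fun k => (k : ℂ) + 1
  let r : ℕ → ℝ → ℂ := fun k s => ((s : ℂ) - Complex.I * m k)⁻¹
  let r' : ℕ → ℝ → ℂ := fun k s => ((s : ℂ) - -Complex.I * m k)⁻¹
  have hz : ∀ k, (Complex.I * m k).im ≠ 0 := fun k => by
    simpa [m] using Nat.cast_add_one_ne_zero (R := ℝ) k
  have hz' : ∀ k, (-Complex.I * m k).im ≠ 0 := fun k => by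
    rw [neg_mul, Complex.neg_im]
    exact neg_ne_zero.2 (hz k)
  have hr : ∀ k, HasBoundedSymbol Φ (r k) := fun k => resolvent hH hcore hC hΦ (hz k)
  have hr' : ∀ k, HasBoundedSymbol Φ (r' k) := fun k => resolvent hH hcore hC hΦ (hz' k)
  have hrs : ∀ k (s : ℝ), (s : ℂ) * r k s = 1 + Complex.I * m k * r k s := fun k s => by
    have := mul_inv_cancel₀ (ofReal_sub_ne_zero s (hz k))
    linear_combination this
  have hrs' : ∀ k (s : ℝ), (s : ℂ) * r' k s = 1 + -Complex.I * m k * r' k s := fun k s => by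
    have := mul_inv_cancel₀ (ofReal_sub_ne_zero s (hz' k))
    linear_combination this
  -- With m = k+1 this is m²/(s² + m²), which tends to 1 and is at most 1. Each of its two
  -- resolvents absorbs one factor s through s(s ∓ im)⁻¹ = 1 ± im(s ∓ im)⁻¹, so f₁ and f₂ remain
  -- polynomials in resolvents times f.
  let g : ℕ → ℝ → ℂ := fun k s => m k ^ 2 * (r k s * r' k s)
  have hg : ∀ k s, g k s = (((k + 1 : ℝ) ^ 2 / (s ^ 2 + (k + 1) ^ 2) : ℝ) : ℂ) := fun k s => by
    have h1 := ofReal_sub_ne_zero s (hz k)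
    have h2 := ofReal_sub_ne_zero s (hz' k)
    have h3 : ((s : ℂ) - Complex.I * m k) * (s - -Complex.I * m k) = s ^ 2 + (k + 1) ^ 2 := by
      simp only [m]
      linear_combination (-(k + 1 : ℂ) ^ 2) * Complex.I_sq
    simp only [g, r, r']
    rw [← mul_inv, h3]
    push_cast
    rw [div_eq_mul_inv]
  have hgb : ∀ k s, ‖g k s‖ ≤ 1 := fun k s => by
    rw [hg, Complex.norm_real, Real.norm_of_nonneg (by positivity), div_le_one (by positivity)]
    nlinarith [sq_nonneg s]
  have hgS : ∀ k, HasBoundedSymbol Φ (g k) := fun k =>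
    (const hΦ (m k ^ 2)).mul hΦ ((hr k).mul hΦ (hr' k))
  have hlim : Tendsto (fun k => Φ (fun s => g k s * f s) u) atTop (𝓝 (Φ f u)) := by
    refine hΦ.tendsto _ _ 2 (fun k => (hgS k).1.1.mul hf.1.1) (fun k s => ?_) (fun s => ?_) u
    · change ‖g k s * f s‖ ≤ 2
      rw [norm_mul]
      nlinarith [hgb k s, hf2 s, norm_nonneg (g k s), norm_nonneg (f s)]
    · have h1 : Tendsto (fun k : ℕ => ((k : ℝ) + 1) ^ 2 / (s ^ 2 + (k + 1) ^ 2)) atTop (𝓝 1) := by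
        have h2 : Tendsto (fun k : ℕ => s ^ 2 + ((k : ℝ) + 1) ^ 2) atTop atTop :=
          tendsto_atTop_add_const_left _ _ ((tendsto_pow_atTop two_ne_zero).comp
            (tendsto_atTop_add_const_right _ _ tendsto_natCast_atTop_atTop))
        have h3 := (tendsto_const_nhds (x := (1 : ℝ))).sub (h2.const_div_atTop (s ^ 2))
        rw [sub_zero] at h3
        refine h3.congr fun k => ?_
        have : s ^ 2 + ((k : ℝ) + 1) ^ 2 ≠ 0 := by positivity
        field_simp
        ring
      have h4 := ((Complex.continuous_ofReal.tendsto _).comp h1).mul_const (f s)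
      simp only [Complex.ofReal_one, one_mul] at h4
      refine h4.congr fun k => ?_
      change _ = g k s * f s
      rw [hg]
      rfl
  obtain ⟨k, hk⟩ := ((tendsto_iff_norm_sub_tendsto_zero.1 hlim).eventually_lt_const
    (half_pos hδ)).exists
  refine ⟨fun s => g k s * f s,
    fun s => m k ^ 2 * ((1 + Complex.I * m k * r k s) * r' k s) * f s,
    fun s => m k ^ 2 * ((1 + Complex.I * m k * r k s) * (1 + -Complex.I * m k * r' k s)) * f s,
    (hgS k).mul hΦ hf, ?_, ?_, fun s => ?_, fun s => ?_, fun s => ?_, ?_⟩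
  · exact ((const hΦ (m k ^ 2)).mul hΦ (((const hΦ 1).add hΦ
      ((const hΦ (Complex.I * m k)).mul hΦ (hr k))).mul hΦ (hr' k))).mul hΦ hf
  · exact ((const hΦ (m k ^ 2)).mul hΦ (((const hΦ 1).add hΦ
      ((const hΦ (Complex.I * m k)).mul hΦ (hr k))).mul hΦ ((const hΦ 1).add hΦ
      ((const hΦ (-Complex.I * m k)).mul hΦ (hr' k))))).mul hΦ hf
  · simp only [g]
    rw [← hrs]
    ring
  · simp only []
    rw [← hrs']
    ring
  · rw [norm_mul]
    nlinarith [hgb k s, hf2 s, norm_nonneg (g k s), norm_nonneg (f s)]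
  · calc _ ≤ _ := norm_sub_le_norm_sub_add_norm_sub _ (Φ f u) _
      _ < δ := by linarith

end HasBoundedSymbol

end Approximation

/-! ### The unitary group and its generator. -/

section Group

variable {E : Type*} [NormedAddCommGroup E] [InnerProductSpace ℂ E] [CompleteSpace E]
  {H : E →ₗ.[ℂ] E} {Φ : (ℝ → ℂ) → (E →L[ℂ] E)}

theorem hasDerivAt_phase (t s : ℝ) :
    HasDerivAt (fun t => phase t s) (-Complex.I * s * phase t s) t := by
  have h1 : HasDerivAt (fun t : ℝ => -Complex.I * (t : ℂ) * s) (-Complex.I * 1 * s) t :=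
    (((hasDerivAt_id t).ofReal_comp).const_mul (-Complex.I)).mul_const (s : ℂ)
  have h2 := h1.cexp
  rw [mul_one, mul_comm] at h2
  exact h2

theorem norm_phase_sub_one_le (t s : ℝ) : ‖phase t s - 1‖ ≤ |t| * |s| := by
  have h := Real.norm_exp_I_mul_ofReal_sub_one_le (x := -(t * s))
  rw [Real.norm_eq_abs, abs_neg, abs_mul] at h
  rw [phase, show -Complex.I * t * s = Complex.I * ((-(t * s) : ℝ) : ℂ) by push_cast; ring]
  exact h

theorem IsBorelCalculus.continuous_phase_apply (hΦ : IsBorelCalculus H Φ) (v : E) :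
    Continuous fun t => Φ (phase t) v :=
  continuous_iff_continuousAt.2 fun t => hΦ.tendsto_filter (M := 1)
    (fun t => (bddBorel_phase t).1) (Eventually.of_forall fun t s => (norm_phase t s).le)
    (fun s => (hasDerivAt_phase t s).continuousAt) v

theorem IsBorelCalculus.phase_add_apply (hΦ : IsBorelCalculus H Φ) (t t' : ℝ) (v : E) :
    Φ (phase (t + t')) v = Φ (phase t) (Φ (phase t') v) := by
  rw [hΦ.mul_apply (bddBorel_phase t) (bddBorel_phase t')]
  simp only [← phase_add]

theorem IsBorelCalculus.phase_zero_apply (hΦ : IsBorelCalculus H Φ) (v : E) :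
    Φ (phase 0) v = v := by
  have : phase 0 = fun _ => 1 := funext phase_zero
  rw [this, hΦ.map_const, one_smul, one_apply_eq_self]

/-- `i d/dt e^{-itH} f(H) v = e^{-itH} H f(H) v`. -/
theorem IsBorelCalculus.hasDerivAt_phase_apply (hΦ : IsBorelCalculus H Φ) {f g : ℝ → ℂ}
    (hf : BddBorel f) (hg : BddBorel g) (hfg : ∀ s : ℝ, g s = s * f s) (v : E) (t : ℝ) :
    HasDerivAt (fun t => Φ (phase t) (Φ f v)) (-Complex.I • Φ (phase t) (Φ g v)) t := by
  rw [hasDerivAt_iff_tendsto_slope_zero]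
  have hp : ∀ t, BddBorel fun s => phase t s * f s := fun t => (bddBorel_phase t).mul hf
  have hrw : ∀ h : ℝ, h⁻¹ • (Φ (phase (t + h)) (Φ f v) - Φ (phase t) (Φ f v)) =
      Φ (fun s => ((h⁻¹ : ℝ) : ℂ) * (phase (t + h) s * f s - phase t s * f s)) v := fun h => by
    have hsub : BddBorel fun s => phase (t + h) s * f s - phase t s * f s := by
      simpa only [neg_one_mul, ← sub_eq_add_neg] using
        (hp (t + h)).add ((BddBorel.const (-1)).mul (hp t))
    rw [hΦ.map_smul hsub, hΦ.map_sub (hp _) (hp _), hΦ.mul_apply (bddBorel_phase _) hf,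
      hΦ.mul_apply (bddBorel_phase _) hf]
    rw [smul_apply, sub_apply, Complex.coe_smul]
  simp only [hrw]
  rw [hΦ.mul_apply (bddBorel_phase _) hg, ← smul_apply, ← hΦ.map_smul ((bddBorel_phase _).mul hg)]
  obtain ⟨hgm, M, hM⟩ := hg
  refine hΦ.tendsto_filter (M := M) (fun h => ?_) ?_ (fun s => ?_) v
  · exact measurable_const.mul ((hp _).1.sub (hp _).1)
  -- The difference quotients are dominated by |s f(s)| = |g(s)| ≤ M.
  · filter_upwards [self_mem_nhdsWithin] with h hh s
    have hh0 : |h| ≠ 0 := abs_ne_zero.2 hh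
    have h1 : ((h⁻¹ : ℝ) : ℂ) * (phase (t + h) s * f s - phase t s * f s) =
        ((h⁻¹ : ℝ) : ℂ) * phase t s * (phase h s - 1) * f s := by
      rw [phase_add]; ring
    rw [h1, norm_mul, norm_mul, norm_mul, norm_phase, Complex.norm_real, Real.norm_eq_abs, abs_inv,
      mul_one]
    calc |h|⁻¹ * ‖phase h s - 1‖ * ‖f s‖ ≤ |h|⁻¹ * (|h| * |s|) * ‖f s‖ := by
          gcongr
          exact norm_phase_sub_one_le h s
      _ = ‖g s‖ := by
          rw [inv_mul_cancel_left₀ hh0, hfg, norm_mul, Complex.norm_real, Real.norm_eq_abs]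
      _ ≤ M := hM s
  · have h1 := (hasDerivAt_iff_tendsto_slope_zero.1 (hasDerivAt_phase t s)).mul_const (f s)
    have h2 : -Complex.I * s * phase t s * f s = -Complex.I * (phase t s * g s) := by
      rw [hfg]; ring
    rw [h2] at h1
    refine h1.congr fun h => ?_
    rw [Complex.real_smul]
    ring

end Group

/-- A function on `ℝ` whose second derivative is at least `m` grows at least like `m t² / 2`. -/
theorem quadratic_lower_bound {φ φ' φ'' : ℝ → ℝ} {m : ℝ} (h : ∀ t, HasDerivAt φ (φ' t) t)
    (h' : ∀ t, HasDerivAt φ' (φ'' t) t) (hm : ∀ t, m ≤ φ'' t) {t : ℝ} (ht : 0 ≤ t) :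
    φ 0 + φ' 0 * t + m / 2 * t ^ 2 ≤ φ t := by
  have h1 : Monotone fun t => φ' t - m * t := by
    have hd : ∀ t, HasDerivAt (fun t => φ' t - m * t) (φ'' t - m * 1) t := fun t =>
      (h' t).sub ((hasDerivAt_id t).const_mul m)
    refine monotone_of_deriv_nonneg (fun t => (hd t).differentiableAt) fun t => ?_
    rw [(hd t).deriv]
    linarith [hm t]
  have hd : ∀ t, HasDerivAt (fun t => φ t - φ' 0 * t - m / 2 * t ^ 2)
      (φ' t - φ' 0 * 1 - m / 2 * (2 * t)) t := fun t => by
    have h2 : HasDerivAt (fun t : ℝ => t ^ 2) (2 * t) t := by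
      simpa using hasDerivAt_pow 2 t
    exact ((h t).sub ((hasDerivAt_id t).const_mul (φ' 0))).sub (h2.const_mul (m / 2))
  have h2 : MonotoneOn (fun t => φ t - φ' 0 * t - m / 2 * t ^ 2) (Set.Ici 0) := by
    refine monotoneOn_of_deriv_nonneg (convex_Ici 0)
      (fun t _ => (hd t).continuousAt.continuousWithinAt)
      (fun t _ => (hd t).differentiableAt.differentiableWithinAt) fun t ht => ?_
    rw [interior_Ici] at ht
    rw [(hd t).deriv]
    have := h1 (le_of_lt ht)
    simp only [mul_zero, sub_zero] at this
    linarith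
  have h3 := h2 (Set.mem_Ici.2 le_rfl) ht ht
  simp only [mul_zero, sub_zero] at h3
  nlinarith

/-! ### Time evolution of the weighted norm. -/

section Dynamics

variable {d : ℕ} {H : L2 d →ₗ.[ℂ] L2 d} {Φ : (ℝ → ℂ) → (L2 d →L[ℂ] L2 d)} {K : ℝ}

/-- The orbit `e^{-itH} w` of a vector `w ∈ 𝓗¹`. -/
def orbit (hU : ∀ t, CommutatorBound (Φ (phase t)) (|t| * K)) (w : (weightOp d).domain) (t : ℝ) :
    (weightOp d).domain :=
  ⟨Φ (phase t) w, (hU t).mem_domain w⟩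

variable (hΦ : IsBorelCalculus H Φ) (hU : ∀ t, CommutatorBound (Φ (phase t)) (|t| * K))

theorem coe_orbit (w : (weightOp d).domain) (t : ℝ) :
    ((orbit hU w t : (weightOp d).domain) : L2 d) = Φ (phase t) w := rfl

include hΦ

/-- Moving Q past e^{-i(t-t₀)H} costs at most |t - t₀|K‖y‖ with y the orbit at t₀, so strong
continuity on ℓ² transfers to 𝓗¹. -/
theorem continuous_weightOp_orbit (w : (weightOp d).domain) :
    Continuous fun t => weightOp d (orbit hU w t) := by
  rw [continuous_iff_continuousAt]
  intro t₀
  set y := orbit hU w t₀ with hy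
  have hb : ∀ t, ‖weightOp d (orbit hU w t) - weightOp d y‖ ≤ |t - t₀| * K * ‖(y : L2 d)‖ +
      ‖Φ (phase (t - t₀)) (weightOp d y) - weightOp d y‖ := fun t => by
    have h1 : ((orbit hU w t : (weightOp d).domain) : L2 d) = Φ (phase (t - t₀)) (y : L2 d) := by
      rw [hy, coe_orbit, coe_orbit, ← hΦ.phase_add_apply, sub_add_cancel]
    have h2 := (hU (t - t₀)).norm_weightOp_sub_le y (orbit hU w t) h1
    exact (norm_sub_le_norm_sub_add_norm_sub _ (Φ (phase (t - t₀)) (weightOp d y)) _).trans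
      (add_le_add_left h2 _)
  have hlim : Tendsto (fun t => |t - t₀| * K * ‖(y : L2 d)‖ +
      ‖Φ (phase (t - t₀)) (weightOp d y) - weightOp d y‖) (𝓝 t₀) (𝓝 0) := by
    have hc : Continuous fun t => |t - t₀| * K * ‖(y : L2 d)‖ +
        ‖Φ (phase (t - t₀)) (weightOp d y) - weightOp d y‖ := by
      have := (hΦ.continuous_phase_apply (weightOp d y)).comp (continuous_id.sub continuous_const :
        Continuous fun t : ℝ => t - t₀)
      exact (by fun_prop : Continuous fun t : ℝ => |t - t₀| * K * ‖(y : L2 d)‖).add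
        (this.sub continuous_const).norm
    have h := hc.tendsto t₀
    simpa [hΦ.phase_zero_apply] using h
  exact tendsto_iff_norm_sub_tendsto_zero.2
    (squeeze_zero (fun _ => norm_nonneg _) hb hlim)

/-- `i d/dt Q e^{-itH} w = Q e^{-itH} H w` for `w = f(H) v` with `w, H w ∈ 𝓗¹`. -/
theorem hasDerivAt_weightOp_orbit {f g : ℝ → ℂ} (hf : BddBorel f) (hg : BddBorel g)
    (hfg : ∀ s : ℝ, g s = s * f s) (v : L2 d) (w w' : (weightOp d).domain)
    (hw : (w : L2 d) = Φ f v) (hw' : (w' : L2 d) = Φ g v) (t : ℝ) :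
    HasDerivAt (fun t => weightOp d (orbit hU w t))
      (-Complex.I • weightOp d (orbit hU w' t)) t := by
  set G : ℝ → L2 d := fun t => -Complex.I • weightOp d (orbit hU w' t) with hG
  have hGc : Continuous G := 
    (continuous_weightOp_orbit hΦ hU w').const_smul (-Complex.I)
  have hev : ∀ (n : Fin d → ℤ) (x : L2 d), innerSL ℂ (lp.single 2 n (1 : ℂ) : L2 d) x = x n :=
    fun n x => by
      rw [innerSL_apply_apply, lp.inner_single_left]
      simp
  -- Q is unbounded and cannot be applied to a derivative in ℓ². Each coordinate is differentiated
  -- and integrated instead; `G` is continuous in ℓ², so the vector-valued integral can then be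
  -- differentiated.
  have hint : ∀ t, weightOp d (orbit hU w t) =
      weightOp d (orbit hU w 0) + ∫ s in (0 : ℝ)..t, G s := by
    intro t
    ext n
    have hd : ∀ s, HasDerivAt (fun s => weightOp d (orbit hU w s) n) (G s n) s := fun s => by
      have h1 := hΦ.hasDerivAt_phase_apply hf hg hfg v s
      have h2 := (((innerSL ℂ (lp.single 2 n (1 : ℂ) : L2 d)).restrictScalars ℝ).hasFDerivAt
        (x := Φ (phase s) (Φ f v))).comp_hasDerivAt s h1
      have h3 := h2.const_mul ((bracket n : ℝ) : ℂ)
      simp only [ContinuousLinearMap.coe_restrictScalars', Function.comp_apply] at h3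
      have hfun : (fun s => weightOp d (orbit hU w s) n) = fun s => ((bracket n : ℝ) : ℂ) *
          innerSL ℂ (lp.single 2 n (1 : ℂ) : L2 d) (Φ (phase s) (Φ f v)) := by
        funext s
        rw [hev, weightOp_apply, coe_orbit, hw]
      have hval : G s n = ((bracket n : ℝ) : ℂ) *
          innerSL ℂ (lp.single 2 n (1 : ℂ) : L2 d) (-Complex.I • Φ (phase s) (Φ g v)) := by
        rw [hev, hG]
        simp only [lp.coeFn_smul, Pi.smul_apply, weightOp_apply, coe_orbit, hw', smul_eq_mul]
        ring
      rw [hfun, hval]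
      exact h3
    have hGn : ∫ s in (0 : ℝ)..t, G s n = (∫ s in (0 : ℝ)..t, G s) n := by
      rw [← hev, ← ContinuousLinearMap.intervalIntegral_comp_comm _
        (hGc.intervalIntegrable 0 t)]
      simp only [hev]
    have hGnc : Continuous fun s => G s n := by
      simp only [← hev]
      exact (ContinuousLinearMap.continuous _).comp hGc
    rw [lp.coeFn_add, Pi.add_apply, ← hGn, intervalIntegral.integral_eq_sub_of_hasDerivAt
      (fun s _ => hd s) (hGnc.intervalIntegrable 0 t)]
    ring
  have h := (intervalIntegral.integral_hasDerivAt_right (hGc.intervalIntegrable 0 t)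
    (hGc.stronglyMeasurableAtFilter _ _) hGc.continuousAt).const_add (weightOp d (orbit hU w 0))
  exact h.congr_of_eventuallyEq (Eventually.of_forall hint)

variable {B : L2 d →L[ℂ] L2 d} {θ : ℝ} {I : Set ℝ}

/-- The second time derivative of `‖Q e^{-itH} w‖²` is `⟨e^{-itH} w, B e^{-itH} w⟩`, so a lower
bound on the latter makes the former grow quadratically. -/
theorem norm_weightOp_orbit_sq_ge (hB : IsDoubleCommutator H B) {f₀ f₁ f₂ : ℝ → ℂ}
    (hf₀ : BddBorel f₀) (hf₁ : BddBorel f₁) (hf₂ : BddBorel f₂)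
    (h₁ : ∀ s : ℝ, f₁ s = s * f₀ s) (h₂ : ∀ s : ℝ, f₂ s = s * f₁ s) (v : L2 d)
    (w₀ w₁ w₂ : (weightOp d).domain) (hw₀ : (w₀ : L2 d) = Φ f₀ v) (hw₁ : (w₁ : L2 d) = Φ f₁ v)
    (hw₂ : (w₂ : L2 d) = Φ f₂ v) {m : ℝ}
    (hm : ∀ t, m ≤ (⟪Φ (phase t) w₀, B (Φ (phase t) w₀)⟫_ℂ).re) :
    ∃ a b : ℝ, ∀ t, 0 ≤ t → a + b * t + m / 2 * t ^ 2 ≤ ‖weightOp d (orbit hU w₀ t)‖ ^ 2 := by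
  set F₀ : ℝ → L2 d := fun t => weightOp d (orbit hU w₀ t) with hF₀
  set F₁ : ℝ → L2 d := fun t => weightOp d (orbit hU w₁ t) with hF₁
  set F₂ : ℝ → L2 d := fun t => weightOp d (orbit hU w₂ t) with hF₂
  have hd₀ : ∀ t, HasDerivAt F₀ (-Complex.I • F₁ t) t :=
    hasDerivAt_weightOp_orbit hΦ hU hf₀ hf₁ h₁ v w₀ w₁ hw₀ hw₁
  have hd₁ : ∀ t, HasDerivAt F₁ (-Complex.I • F₂ t) t :=
    hasDerivAt_weightOp_orbit hΦ hU hf₁ hf₂ h₂ v w₁ w₂ hw₁ hw₂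
  have hψ : ∀ t, HasDerivAt (fun t => ⟪F₀ t, F₀ t⟫_ℂ)
      (-Complex.I * ⟪F₀ t, F₁ t⟫_ℂ + Complex.I * ⟪F₁ t, F₀ t⟫_ℂ) t := fun t => by
    have h := (hd₀ t).inner ℂ (hd₀ t)
    rw [inner_smul_left, inner_smul_right] at h
    simpa using h
  have hψ' : ∀ t, HasDerivAt
      (fun t => -Complex.I * ⟪F₀ t, F₁ t⟫_ℂ + Complex.I * ⟪F₁ t, F₀ t⟫_ℂ)
      (2 * ⟪F₁ t, F₁ t⟫_ℂ - ⟪F₀ t, F₂ t⟫_ℂ - ⟪F₂ t, F₀ t⟫_ℂ) t := fun t => by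
    have h3 := (((hd₀ t).inner ℂ (hd₁ t)).const_mul (-Complex.I)).add
      (((hd₁ t).inner ℂ (hd₀ t)).const_mul Complex.I)
    refine HasDerivAt.congr_deriv (f := fun t => _) h3 ?_
    simp only [inner_smul_left, inner_smul_right, map_neg, Complex.conj_I]
    linear_combination (-2 * ⟪F₁ t, F₁ t⟫_ℂ + ⟪F₀ t, F₂ t⟫_ℂ + ⟪F₂ t, F₀ t⟫_ℂ) * Complex.I_sq
  -- Expanding the double commutator form on the diagonal yields exactly the second derivative found
  -- above.
  have hcomm : ∀ t, ⟪Φ (phase t) w₀, B (Φ (phase t) w₀)⟫_ℂ =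
      2 * ⟪F₁ t, F₁ t⟫_ℂ - ⟪F₀ t, F₂ t⟫_ℂ - ⟪F₂ t, F₀ t⟫_ℂ := fun t => by
    have hg : ∀ {f g : ℝ → ℂ} (w w' : (weightOp d).domain), BddBorel f → BddBorel g →
        (∀ s : ℝ, g s = s * f s) → (w : L2 d) = Φ f v → (w' : L2 d) = Φ g v →
        ((orbit hU w t : L2 d), (orbit hU w' t : L2 d)) ∈ H.graph := by
      intro f g w w' hf hg hfg hw hw'
      rw [coe_orbit, coe_orbit, hw, hw', hΦ.comm_apply (bddBorel_phase t) hf,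
        hΦ.comm_apply (bddBorel_phase t) hg]
      exact hΦ.mem_graph hf hg hfg _
    have h := hB (orbit hU w₀ t) (orbit hU w₁ t) (orbit hU w₂ t) (orbit hU w₀ t) (orbit hU w₁ t)
      (orbit hU w₂ t) (hg w₀ w₁ hf₀ hf₁ h₁ hw₀ hw₁) (hg w₁ w₂ hf₁ hf₂ h₂ hw₁ hw₂)
      (hg w₀ w₁ hf₀ hf₁ h₁ hw₀ hw₁) (hg w₁ w₂ hf₁ hf₂ h₂ hw₁ hw₂)
    simp only [coe_orbit, commForm] at h
    rw [h]
    simp only [hF₀, hF₁, hF₂]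
    ring
  have hre : ∀ {ψ : ℝ → ℂ} {ψ' : ℂ} {t : ℝ}, HasDerivAt ψ ψ' t →
      HasDerivAt (fun t => (ψ t).re) ψ'.re t := fun {ψ ψ' t} h =>
    Complex.reCLM.hasFDerivAt.comp_hasDerivAt t h
  refine ⟨_, _, fun t ht => (quadratic_lower_bound (fun t => hre (hψ t)) (fun t => hre (hψ' t))
    (fun t => by rw [← hcomm]; exact hm t) ht).trans_eq ?_⟩
  exact inner_self_eq_norm_sq (𝕜 := ℂ) (F₀ t)

/-- For w only close to the range of P: splitting w = Pw + (w - Pw) leaves two error terms, each at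
most ‖B‖‖w - Pw‖‖w‖. -/
theorem re_inner_ge_of_mourre (hI : MeasurableSet I)
    (hM : (θ : ℂ) • Φ (I.indicator 1) ≤ Φ (I.indicator 1) * B * Φ (I.indicator 1)) (w : L2 d) :
    θ * ‖Φ (I.indicator 1) w‖ ^ 2 - 2 * ‖B‖ * ‖w - Φ (I.indicator 1) w‖ * ‖w‖ ≤
      (⟪w, B w⟫_ℂ).re := by
  set P := Φ (I.indicator 1) with hP
  have hIb := BddBorel.indicator hI
  have hPP : ∀ x y : L2 d, ⟪P x, P y⟫_ℂ = ⟪x, P y⟫_ℂ := fun x y => by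
    rw [hΦ.inner_map_map hIb hIb]
    congr 3
    ext s
    by_cases hs : s ∈ I <;> simp [hs]
  have hPsymm : ∀ x y : L2 d, ⟪P x, y⟫_ℂ = ⟪x, P y⟫_ℂ := fun x y => by
    rw [← hPP x y, ← inner_conj_symm, ← hPP y x, inner_conj_symm]
  have hPn : ‖P w‖ ≤ ‖w‖ := by
    have := hΦ.norm_apply_le hIb.1 (M := 1) (fun s => by by_cases hs : s ∈ I <;> simp [hs]) w
    simpa using this
  have h1 := (ContinuousLinearMap.le_def _ _).1 hM |>.re_inner_nonneg_right w
  rw [sub_apply, inner_sub_right, mul_apply_eq_comp, mul_apply_eq_comp, smul_apply,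
    inner_smul_right, ← hPsymm, ← hPP w w, inner_self_eq_norm_sq_to_K] at h1
  have h2 : θ * ‖P w‖ ^ 2 ≤ (⟪P w, B (P w)⟫_ℂ).re := by
    have h3 : ((θ : ℂ) * (((‖P w‖ : ℝ) : ℂ)) ^ 2).re = θ * ‖P w‖ ^ 2 := by
      rw [← Complex.ofReal_pow, ← Complex.ofReal_mul, Complex.ofReal_re]
    simp only [map_sub, RCLike.re_eq_complex_re] at h1
    erw [h3] at h1
    linarith
  have h4 : ⟪w, B w⟫_ℂ = ⟪P w, B (P w)⟫_ℂ + ⟪w - P w, B w⟫_ℂ + ⟪P w, B (w - P w)⟫_ℂ := by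
    rw [map_sub, inner_sub_left, inner_sub_right]
    ring
  have h5 : |(⟪w - P w, B w⟫_ℂ).re| ≤ ‖B‖ * ‖w - P w‖ * ‖w‖ := by
    refine (Complex.abs_re_le_norm _).trans ((norm_inner_le_norm _ _).trans ?_)
    rw [mul_comm ‖B‖, mul_assoc]
    exact mul_le_mul_of_nonneg_left (B.le_opNorm w) (norm_nonneg _)
  have h6 : |(⟪P w, B (w - P w)⟫_ℂ).re| ≤ ‖B‖ * ‖w - P w‖ * ‖w‖ := by
    refine (Complex.abs_re_le_norm _).trans ((norm_inner_le_norm _ _).trans ?_)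
    rw [mul_comm]
    exact mul_le_mul (B.le_opNorm _) hPn (norm_nonneg _) (by positivity)
  rw [h4, Complex.add_re, Complex.add_re]
  linarith [abs_le.1 h5, abs_le.1 h6]

end Dynamics

/-! ### Linear growth of the weighted norm. -/

section LowerBound

variable {d : ℕ} {H : L2 d →ₗ.[ℂ] L2 d} {Φ : (ℝ → ℂ) → (L2 d →L[ℂ] L2 d)}
  {C B : L2 d →L[ℂ] L2 d} {θ : ℝ} {I : Set ℝ}

/-- Transfers growth from the regularised orbit to that of u: f(H) commutes with the evolution, and
the commutator term is constant in t because the evolution is isometric. -/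
theorem norm_weightOp_orbit_le (hΦ : IsBorelCalculus H Φ) {f : ℝ → ℂ} {M K : ℝ} (hf : BddBorel f)
    (hf2 : ∀ s, ‖f s‖ ≤ 2) (hfM : CommutatorBound (Φ f) M)
    (hU : ∀ t, CommutatorBound (Φ (phase t)) (|t| * K)) (u w : (weightOp d).domain)
    (hw : (w : L2 d) = Φ f u) (t : ℝ) :
    ‖weightOp d (orbit hU w t)‖ ≤ 2 * ‖weightOp d (orbit hU u t)‖ + M * ‖(u : L2 d)‖ := by
  have h1 : ((orbit hU w t : (weightOp d).domain) : L2 d) = Φ f (orbit hU u t : L2 d) := by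
    rw [coe_orbit, coe_orbit, hw, hΦ.comm_apply (bddBorel_phase t) hf]
  have h2 := hfM.norm_weightOp_sub_le (orbit hU u t) (orbit hU w t) h1
  rw [coe_orbit hU u, norm_phase_apply hΦ] at h2
  have h3 := hΦ.norm_apply_le hf.1 hf2 (weightOp d (orbit hU u t))
  have h4 := norm_sub_norm_le (weightOp d (orbit hU w t)) (Φ f (weightOp d (orbit hU u t)))
  linarith

theorem exists_forall_norm_weightOp_orbit_ge (hH : IsSelfAdjoint H)
    (hcore : H.HasCore (finitelySupported d)) (hC : IsCommutator H C) (hΦ : IsBorelCalculus H Φ)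
    (hU : ∀ t, CommutatorBound (Φ (phase t)) (|t| * ‖C‖)) (hB : IsDoubleCommutator H B)
    (hI : MeasurableSet I) (hθ : 0 < θ)
    (hM : (θ : ℂ) • Φ (I.indicator 1) ≤ Φ (I.indicator 1) * B * Φ (I.indicator 1))
    (u : (weightOp d).domain) :
    ∃ T, ∀ t, 0 < t → T ≤ t →
      1 / 8 * √θ * ‖Φ (I.indicator 1) u‖ * t ≤ ‖weightOp d (orbit hU u t)‖ := by
  set P := Φ (I.indicator 1) with hP
  have hIb := BddBorel.indicator hI
  have hI1 : ∀ s, ‖(I.indicator 1 : ℝ → ℂ) s‖ ≤ 1 := fun s => by by_cases hs : s ∈ I <;> simp [hs]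
  have hPn : ∀ x, ‖P x‖ ≤ ‖x‖ := fun x => by simpa using hΦ.norm_apply_le hIb.1 hI1 x
  have hPP : ∀ x, P (P x) = P x := fun x => by
    rw [hΦ.mul_apply hIb hIb]
    congr 2
    ext s
    by_cases hs : s ∈ I <;> simp [hs]
  set p := ‖P u‖ with hp
  rcases (norm_nonneg (P u)).eq_or_lt with h0 | hp0
  · exact ⟨0, fun t _ _ => by rw [hp, ← h0]; simp⟩
  -- δ ≤ p/4 gives ‖Pw‖ ≥ 3p/4 and ‖w‖ ≤ 5p/4. The other bound keeps the Mourre error 2‖B‖(2δ)(5p/4)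
  -- below θp²/16, leaving θp²(9/16 - 1/16) = θp²/2.
  set δ := min (p / 4) (θ * p / (80 * (‖B‖ + 1))) with hδ
  have hδ0 : 0 < δ := by positivity
  have hδp : δ ≤ p / 4 := min_le_left _ _
  have hδB : δ * (80 * (‖B‖ + 1)) ≤ θ * p := by
    rw [← le_div_iff₀ (by positivity)]
    exact min_le_right _ _
  obtain ⟨f₀, f₁, f₂, hf₀, hf₁, hf₂, h₁, h₂, hf2, hfδ⟩ :=
    HasBoundedSymbol.exists_approx_smooth hH hcore hC hΦ hI (u : L2 d) hδ0
  obtain ⟨hf₀b, M, hM₀⟩ := hf₀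
  obtain ⟨hf₁b, M₁, hM₁⟩ := hf₁
  obtain ⟨hf₂b, M₂, hM₂⟩ := hf₂
  set w : L2 d := Φ f₀ u with hw
  have hPw : p - δ ≤ ‖P w‖ := by
    have h3 : ‖P w - P u‖ ≤ δ := by
      rw [← hPP u, ← map_sub]
      exact (hPn _).trans hfδ.le
    have h4 := norm_sub_norm_le (P u) (P w)
    rw [norm_sub_rev] at h4
    linarith
  have hwP : ‖w - P w‖ ≤ 2 * δ := by
    have h3 : w - P w = (w - P u) - P (w - P u) := by
      rw [map_sub, hPP]; abel
    rw [h3]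
    have := hPn (w - P u)
    linarith [norm_sub_le (w - P u) (P (w - P u))]
  have hwn : ‖w‖ ≤ p + δ := by
    have h4 := norm_sub_norm_le w (P u)
    linarith
  have hm : ∀ t, θ * p ^ 2 / 2 ≤ (⟪Φ (phase t) w, B (Φ (phase t) w)⟫_ℂ).re := fun t => by
    refine le_trans ?_ (re_inner_ge_of_mourre hΦ hI hM _)
    have hcomm : Φ (I.indicator 1) (Φ (phase t) w) = Φ (phase t) (P w) :=
      hΦ.comm_apply hIb (bddBorel_phase t) w
    rw [hcomm, ← map_sub, norm_phase_apply hΦ, norm_phase_apply hΦ, norm_phase_apply hΦ]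
    have h3 : θ * (9 / 16 * p ^ 2) ≤ θ * ‖P w‖ ^ 2 := by
      refine mul_le_mul_of_nonneg_left ?_ hθ.le
      have : 3 / 4 * p ≤ ‖P w‖ := by linarith
      nlinarith
    have h4 : ‖B‖ * ‖w - P w‖ * ‖w‖ ≤ ‖B‖ * (2 * δ) * (5 / 4 * p) := by
      have : ‖w‖ ≤ 5 / 4 * p := by linarith
      gcongr
    have h5 : ‖B‖ * δ * p ≤ θ * p ^ 2 / 80 := by
      have : ‖B‖ * δ ≤ θ * p / 80 := by nlinarith
      nlinarith
    nlinarith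
  obtain ⟨a, b, hab⟩ := norm_weightOp_orbit_sq_ge hΦ hU hB hf₀b hf₁b hf₂b h₁ h₂ (u : L2 d)
    ⟨w, hM₀.mem_domain u⟩ ⟨_, hM₁.mem_domain u⟩ ⟨_, hM₂.mem_domain u⟩ rfl rfl rfl hm
  have hθp : 0 < θ * p ^ 2 := by positivity
  have hsp : 0 < √θ * p := by positivity
  -- The quadratic coefficient is θp²/4 = θp²/9 + 5θp²/36; the second part absorbs a + bt, leaving
  -- ‖Q w_t‖ ≥ √θ p t/3. With M‖u‖ ≤ √θ p t/12 the final constant is (1/3 - 1/12)/2 = 1/8. The 1 in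
  -- the maximum ensures t ≥ 1, so that |a| ≤ |a|t.
  obtain ⟨T, hT⟩ : ∃ T : ℝ, ∀ t, T ≤ t →
      0 ≤ a + b * t + 5 / 36 * (θ * p ^ 2) * t ^ 2 ∧ 12 * M * ‖(u : L2 d)‖ ≤ √θ * p * t := by
    refine ⟨max 1 (max ((|a| + |b|) / (5 / 36 * (θ * p ^ 2)))
      (12 * M * ‖(u : L2 d)‖ / (√θ * p))), fun t ht => ?_⟩
    obtain ⟨h3, h4⟩ := max_le_iff.1 ht
    obtain ⟨h5, h6⟩ := max_le_iff.1 h4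
    rw [div_le_iff₀ (by positivity)] at h5 h6
    refine ⟨?_, by linarith⟩
    have h7 : -(|a| * t) ≤ a := by nlinarith [neg_abs_le a, abs_nonneg a]
    have h8 : -(|b| * t) ≤ b * t := by nlinarith [neg_abs_le b]
    nlinarith
  refine ⟨T, fun t ht hTt => ?_⟩
  obtain ⟨h3, h4⟩ := hT t hTt
  have h5 : √θ * p * t / 3 ≤ ‖weightOp d (orbit hU ⟨w, hM₀.mem_domain u⟩ t)‖ := by
    refine abs_le_of_sq_le_sq' ?_ (norm_nonneg _) |>.2
    have h6 : (√θ * p * t / 3) ^ 2 = θ * p ^ 2 * t ^ 2 / 9 := by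
      rw [div_pow, mul_pow, mul_pow, Real.sq_sqrt hθ.le]
      ring
    rw [h6]
    linarith [hab t ht.le]
  have h6 := norm_weightOp_orbit_le hΦ hf₀b hf2 hM₀ hU u ⟨w, hM₀.mem_domain u⟩ rfl t
  linarith

end LowerBound

section Representation

/-! ### Extension of a representation of `C(X)` to bounded Borel functions -/

open scoped ENNReal CompactlySupported

variable {X : Type*} [MeasurableSpace X]

/-- Bounded measurable functions. -/
def BddMeasurable (g : X → ℂ) : Prop :=
  Measurable g ∧ ∃ M : ℝ, ∀ x, ‖g x‖ ≤ M

namespace BddMeasurable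

variable {g h : X → ℂ}

theorem memLp (hg : BddMeasurable g) (ν : Measure X) [IsFiniteMeasure ν] : MemLp g 2 ν := by
  obtain ⟨hg, M, hM⟩ := hg
  exact MemLp.of_bound hg.aestronglyMeasurable M (Eventually.of_forall hM)

theorem add (hg : BddMeasurable g) (hh : BddMeasurable h) : BddMeasurable (g + h) := by
  obtain ⟨hg, M, hM⟩ := hg
  obtain ⟨hh, N, hN⟩ := hh
  exact ⟨hg.add hh, M + N, fun s => (norm_add_le _ _).trans (add_le_add (hM s) (hN s))⟩

theorem neg (hg : BddMeasurable g) : BddMeasurable (-g) := by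
  obtain ⟨hg, M, hM⟩ := hg
  exact ⟨hg.neg, M, fun s => by simpa using hM s⟩

theorem sub (hg : BddMeasurable g) (hh : BddMeasurable h) : BddMeasurable (g - h) := by
  simpa only [sub_eq_add_neg] using hg.add hh.neg

theorem mul (hg : BddMeasurable g) (hh : BddMeasurable h) : BddMeasurable (g * h) := by
  obtain ⟨hg, M, hM⟩ := hg
  obtain ⟨hh, N, hN⟩ := hh
  refine ⟨hg.mul hh, M * N, fun s => ?_⟩
  rw [Pi.mul_apply, norm_mul]
  exact mul_le_mul (hM s) (hN s) (norm_nonneg _) ((norm_nonneg _).trans (hM s))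

theorem star (hg : BddMeasurable g) : BddMeasurable (star g) := by
  obtain ⟨hg, M, hM⟩ := hg
  exact ⟨Complex.continuous_conj.measurable.comp hg, M, fun s => by simpa using hM s⟩

end BddMeasurable

theorem eLpNorm_mul_le {a b : X → ℂ} {M : ℝ} (ha : ∀ x, ‖a x‖ ≤ M) (ν : Measure X) :
    eLpNorm (a * b) 2 ν ≤ ENNReal.ofReal M * eLpNorm b 2 ν := by
  refine eLpNorm_le_mul_eLpNorm_of_ae_le_mul (Eventually.of_forall fun x => ?_) 2
  rw [Pi.mul_apply, norm_mul]
  exact mul_le_mul_of_nonneg_right (ha x) (norm_nonneg _)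

theorem tendsto_eLpNorm_mul {ι : Type*} {l : Filter ι} {a : X → ℂ} {b : ι → X → ℂ}
    (ha : BddMeasurable a) {ν : Measure X} (hb : Tendsto (fun i => eLpNorm (b i) 2 ν) l (𝓝 0)) :
    Tendsto (fun i => eLpNorm (a * b i) 2 ν) l (𝓝 0) := by
  obtain ⟨-, M, hM⟩ := ha
  have h := ENNReal.Tendsto.const_mul (a := ENNReal.ofReal M) hb (Or.inr ENNReal.ofReal_ne_top)
  rw [mul_zero] at h
  exact tendsto_of_tendsto_of_tendsto_of_le_of_le tendsto_const_nhds h (fun _ => zero_le)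
    fun i => eLpNorm_mul_le hM ν

variable [MetricSpace X] [CompactSpace X] [BorelSpace X]

theorem BddMeasurable.of_continuousMap (f : C(X, ℂ)) : BddMeasurable f :=
  ⟨f.continuous.measurable, ‖f‖, f.norm_coe_le_norm⟩

theorem BddMeasurable.exists_seq {g : X → ℂ} (hg : BddMeasurable g) (ν : Measure X)
    [IsFiniteMeasure ν] :
    ∃ F : ℕ → C(X, ℂ), Tendsto (fun n => eLpNorm (⇑(F n) - g) 2 ν) atTop (𝓝 0) := by
  have h : ∀ n : ℕ, ∃ f : C(X, ℂ), eLpNorm (⇑f - g) 2 ν ≤ ((n : ℝ≥0∞) + 1)⁻¹ := fun n => by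
    obtain ⟨f, hf, -⟩ := (hg.memLp ν).exists_boundedContinuous_eLpNorm_sub_le (by simp)
      (ε := ((n : ℝ≥0∞) + 1)⁻¹) (by simp)
    refine ⟨f.toContinuousMap, ?_⟩
    rw [eLpNorm_sub_comm]
    exact hf
  choose F hF using h
  refine ⟨F, tendsto_of_tendsto_of_tendsto_of_le_of_le tendsto_const_nhds ?_
    (fun _ => zero_le) hF⟩
  have := ENNReal.tendsto_inv_nat_nhds_zero.comp (tendsto_add_atTop_nat 1)
  refine this.congr fun n => ?_
  simp

variable {E : Type*} [NormedAddCommGroup E] [InnerProductSpace ℂ E] [CompleteSpace E]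
  (ρ : C(X, ℂ) →⋆ₐ[ℂ] (E →L[ℂ] E)) (μ : E → Measure X)

open Classical in
/-- The extension of a representation of `C(X)` to bounded Borel functions. -/
def borelExt (g : X → ℂ) : E →L[ℂ] E :=
  if h : ∃ T : E →L[ℂ] E, ∀ (v : E) (f : C(X, ℂ)), ‖ρ f v - T v‖ₑ ≤ eLpNorm (⇑f - g) 2 (μ v)
  then h.choose else 0

variable {ρ μ} [∀ v, IsFiniteMeasure (μ v)]
  (hμ : ∀ (v : E) (f : C(X, ℂ)), eLpNorm f 2 (μ v) = ‖ρ f v‖ₑ) {g h : X → ℂ}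
include hμ

/-- By `hμ`, f ↦ ρ(f)v is isometric for the L²(μ_v) norm, and C(X) is dense there. The inequality
over all continuous f pins down y without reference to a chosen sequence. -/
theorem exists_limit (hg : BddMeasurable g) (v : E) :
    ∃ y, ∀ f : C(X, ℂ), ‖ρ f v - y‖ₑ ≤ eLpNorm (⇑f - g) 2 (μ v) := by
  obtain ⟨F, hF⟩ := hg.exists_seq (μ v)
  have hdist : ∀ f n, ‖ρ f v - ρ (F n) v‖ₑ ≤
      eLpNorm (⇑f - g) 2 (μ v) + eLpNorm (⇑(F n) - g) 2 (μ v) := fun f n => by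
    rw [← sub_apply, ← map_sub, ← hμ, ContinuousMap.coe_sub, eLpNorm_sub_comm (⇑(F n)),
      ← sub_add_sub_cancel (⇑f) g]
    exact eLpNorm_add_le (((BddMeasurable.of_continuousMap f).sub hg).1.aestronglyMeasurable)
      ((hg.sub (BddMeasurable.of_continuousMap (F n))).1.aestronglyMeasurable) (by norm_num)
  have hc : CauchySeq fun n => ρ (F n) v := by
    rw [EMetric.cauchySeq_iff]
    intro ε hε
    obtain ⟨N, hN⟩ := eventually_atTop.1 (hF.eventually_lt_const (ENNReal.half_pos hε.ne'))
    refine ⟨N, fun m hm n hn => ?_⟩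
    rw [edist_eq_enorm_sub]
    refine (hdist _ _).trans_lt ?_
    rw [← ENNReal.add_halves ε]
    exact ENNReal.add_lt_add (hN m hm) (hN n hn)
  obtain ⟨y, hy⟩ := cauchySeq_tendsto_of_complete hc
  refine ⟨y, fun f => ?_⟩
  have h1 : Tendsto (fun n => ‖ρ f v - ρ (F n) v‖ₑ) atTop (𝓝 ‖ρ f v - y‖ₑ) :=
    (continuous_enorm.tendsto _).comp (tendsto_const_nhds.sub hy)
  have h2 := tendsto_const_nhds (x := eLpNorm (⇑f - g) 2 (μ v)) |>.add hF
  rw [add_zero] at h2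
  exact le_of_tendsto_of_tendsto' h1 h2 (hdist f)

-- Allowing ν ≥ μ_v lets a single approximating sequence, chosen for a sum of spectral measures,
-- serve several vectors at once.
omit hμ [CompactSpace X] [BorelSpace X] [∀ v, IsFiniteMeasure (μ v)] in
theorem tendsto_limit {v y : E} (hy : ∀ f : C(X, ℂ), ‖ρ f v - y‖ₑ ≤ eLpNorm (⇑f - g) 2 (μ v))
    {ν : Measure X} (hν : μ v ≤ ν) {F : ℕ → C(X, ℂ)}
    (hF : Tendsto (fun n => eLpNorm (⇑(F n) - g) 2 ν) atTop (𝓝 0)) :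
    Tendsto (fun n => ρ (F n) v) atTop (𝓝 y) := by
  rw [tendsto_iff_edist_tendsto_0]
  refine tendsto_of_tendsto_of_tendsto_of_le_of_le tendsto_const_nhds hF (fun _ => zero_le)
    fun n => ?_
  rw [edist_eq_enorm_sub]
  exact (hy _).trans (eLpNorm_mono_measure _ hν)

theorem borelExt_spec (hg : BddMeasurable g) (v : E) (f : C(X, ℂ)) :
    ‖ρ f v - borelExt ρ μ g v‖ₑ ≤ eLpNorm (⇑f - g) 2 (μ v) := by
  have hex : ∃ T : E →L[ℂ] E, ∀ (v : E) (f : C(X, ℂ)),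
      ‖ρ f v - T v‖ₑ ≤ eLpNorm (⇑f - g) 2 (μ v) := by
    choose y hy using exists_limit hμ hg
    obtain ⟨-, M, hM⟩ := id hg
    have hadd : ∀ v w, y (v + w) = y v + y w := fun v w => by
      obtain ⟨F, hF⟩ := hg.exists_seq (μ v + μ w + μ (v + w))
      have h1 := tendsto_limit (hy v) (Measure.le_add_right (Measure.le_add_right le_rfl)) hF
      have h2 := tendsto_limit (hy w) (Measure.le_add_right (Measure.le_add_left le_rfl)) hF
      have h3 := tendsto_limit (hy (v + w)) (Measure.le_add_left le_rfl) hF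
      refine tendsto_nhds_unique h3 ?_
      simpa only [map_add] using h1.add h2
    have hsmul : ∀ (a : ℂ) v, y (a • v) = a • y v := fun a v => by
      obtain ⟨F, hF⟩ := hg.exists_seq (μ v + μ (a • v))
      have h1 := tendsto_limit (hy v) (Measure.le_add_right le_rfl) hF
      have h3 := tendsto_limit (hy (a • v)) (Measure.le_add_left le_rfl) hF
      refine tendsto_nhds_unique h3 ?_
      simpa only [_root_.map_smul] using h1.const_smul a
    have hb : ∀ v, ‖y v‖ ≤ max M 0 * ‖v‖ := fun v => by
      have h1 := hy v 0
      have h2 : eLpNorm (⇑(0 : C(X, ℂ)) - g) 2 (μ v) ≤ ENNReal.ofReal (max M 0) * ‖v‖ₑ := by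
        have h3 := hμ v 1
        rw [map_one, one_apply_eq_self] at h3
        rw [← h3]
        refine eLpNorm_le_mul_eLpNorm_of_ae_le_mul (Eventually.of_forall fun x => ?_) 2
        simpa using Or.inl (hM x)
      have h4 := h1.trans h2
      rw [map_zero, zero_apply, zero_sub, enorm_neg, ← ofReal_norm, ← ofReal_norm,
        ← ENNReal.ofReal_mul (le_max_right _ _), ENNReal.ofReal_le_ofReal_iff (by positivity)] at h4
      exact h4
    exact ⟨LinearMap.mkContinuous { toFun := y, map_add' := hadd, map_smul' := hsmul } _ hb, hy⟩
  rw [borelExt, dif_pos hex]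
  exact hex.choose_spec v f

theorem tendsto_borelExt (hg : BddMeasurable g) {v : E} {ν : Measure X} (hν : μ v ≤ ν)
    {F : ℕ → C(X, ℂ)} (hF : Tendsto (fun n => eLpNorm (⇑(F n) - g) 2 ν) atTop (𝓝 0)) :
    Tendsto (fun n => ρ (F n) v) atTop (𝓝 (borelExt ρ μ g v)) :=
  tendsto_limit (borelExt_spec hμ hg v) hν hF

theorem borelExt_coe (f : C(X, ℂ)) : borelExt ρ μ f = ρ f := by
  ext v
  have h := borelExt_spec hμ (BddMeasurable.of_continuousMap f) v f
  rw [sub_self, eLpNorm_zero, nonpos_iff_eq_zero, enorm_eq_zero, sub_eq_zero] at h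
  exact h.symm

theorem enorm_borelExt_le (hg : BddMeasurable g) (v : E) :
    ‖borelExt ρ μ g v‖ₑ ≤ eLpNorm g 2 (μ v) := by
  have h := borelExt_spec hμ hg v 0
  rw [map_zero, zero_apply, zero_sub, enorm_neg, ContinuousMap.coe_zero, zero_sub,
    eLpNorm_neg] at h
  exact h

theorem borelExt_add (hg : BddMeasurable g) (hh : BddMeasurable h) :
    borelExt ρ μ (g + h) = borelExt ρ μ g + borelExt ρ μ h := by
  ext v
  obtain ⟨F, hF⟩ := hg.exists_seq (μ v)
  obtain ⟨G, hG⟩ := hh.exists_seq (μ v)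
  have hFG : Tendsto (fun n => eLpNorm (⇑(F n + G n) - (g + h)) 2 (μ v)) atTop (𝓝 0) := by
    have h1 := hF.add hG
    rw [add_zero] at h1
    refine tendsto_of_tendsto_of_tendsto_of_le_of_le tendsto_const_nhds h1 (fun _ => zero_le)
      fun n => ?_
    rw [ContinuousMap.coe_add, add_sub_add_comm]
    exact eLpNorm_add_le ((BddMeasurable.of_continuousMap (F n)).sub hg).1.aestronglyMeasurable
      ((BddMeasurable.of_continuousMap (G n)).sub hh).1.aestronglyMeasurable (by norm_num)
  refine tendsto_nhds_unique (tendsto_borelExt hμ (hg.add hh) le_rfl hFG) ?_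
  simpa only [map_add, add_apply] using
    (tendsto_borelExt hμ hg le_rfl hF).add (tendsto_borelExt hμ hh le_rfl hG)

theorem borelExt_sub (hg : BddMeasurable g) (hh : BddMeasurable h) :
    borelExt ρ μ (g - h) = borelExt ρ μ g - borelExt ρ μ h := by
  rw [eq_sub_iff_add_eq, ← borelExt_add hμ (hg.sub hh) hh, sub_add_cancel]

theorem borelExt_mul_coe (f : C(X, ℂ)) (hh : BddMeasurable h) (v : E) :
    borelExt ρ μ (⇑f * h) v = ρ f (borelExt ρ μ h v) := by
  obtain ⟨G, hG⟩ := hh.exists_seq (μ v)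
  have hf := BddMeasurable.of_continuousMap f
  have hfG : Tendsto (fun n => eLpNorm (⇑(f * G n) - ⇑f * h) 2 (μ v)) atTop (𝓝 0) := by
    simp only [ContinuousMap.coe_mul, ← mul_sub]
    exact tendsto_eLpNorm_mul hf hG
  refine tendsto_nhds_unique (tendsto_borelExt hμ (hf.mul hh) le_rfl hfG) ?_
  simp only [map_mul, mul_apply_eq_comp]
  exact ((ρ f).continuous.tendsto _).comp (tendsto_borelExt hμ hh le_rfl hG)

/-- Approximate g by continuous F_n for μ_v and for the measure of the vector h·v together: F_n h →
gh in L²(μ_v) as h is bounded, while ρ(F_n) converges on h·v. -/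
theorem borelExt_mul (hg : BddMeasurable g) (hh : BddMeasurable h) :
    borelExt ρ μ (g * h) = borelExt ρ μ g * borelExt ρ μ h := by
  ext v
  obtain ⟨F, hF⟩ := hg.exists_seq (μ v + μ (borelExt ρ μ h v))
  refine tendsto_nhds_unique (f := fun n => borelExt ρ μ (⇑(F n) * h) v) ?_ ?_ (l := atTop)
  · rw [tendsto_iff_edist_tendsto_0]
    have h1 : Tendsto (fun n => eLpNorm (⇑(F n) - g) 2 (μ v)) atTop (𝓝 0) :=
      tendsto_of_tendsto_of_tendsto_of_le_of_le tendsto_const_nhds hF (fun _ => zero_le)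
        fun n => eLpNorm_mono_measure _ (Measure.le_add_right le_rfl)
    refine tendsto_of_tendsto_of_tendsto_of_le_of_le tendsto_const_nhds
      (tendsto_eLpNorm_mul hh h1) (fun _ => zero_le) fun n => ?_
    have hFn := BddMeasurable.of_continuousMap (F n)
    rw [edist_eq_enorm_sub, ← sub_apply, ← borelExt_sub hμ (hFn.mul hh) (hg.mul hh), ← sub_mul,
      mul_comm]
    exact enorm_borelExt_le hμ (hh.mul (hFn.sub hg)) v
  · simp only [borelExt_mul_coe hμ _ hh]
    exact tendsto_borelExt hμ hg (Measure.le_add_left le_rfl) hF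

theorem borelExt_star (hg : BddMeasurable g) :
    borelExt ρ μ (star g) = star (borelExt ρ μ g) := by
  rw [ContinuousLinearMap.star_eq_adjoint, ContinuousLinearMap.eq_adjoint_iff]
  intro v w
  obtain ⟨F, hF⟩ := hg.exists_seq (μ v + μ w)
  have hF' : Tendsto (fun n => eLpNorm (⇑(star (F n)) - star g) 2 (μ v + μ w)) atTop (𝓝 0) := by
    refine hF.congr fun n => ?_
    rw [ContinuousMap.coe_star, ← star_sub]
    exact eLpNorm_congr_norm_ae (Eventually.of_forall fun x => (norm_star _).symm)
  have h1 := (tendsto_borelExt hμ hg.star (v := v) (Measure.le_add_right le_rfl) hF').inner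
    (𝕜 := ℂ) (tendsto_const_nhds (x := w))
  have h2 := (tendsto_const_nhds (x := v)).inner (𝕜 := ℂ)
    (tendsto_borelExt hμ hg (v := w) (Measure.le_add_left le_rfl) hF)
  refine tendsto_nhds_unique h1 (h2.congr fun n => ?_)
  rw [map_star, ContinuousLinearMap.star_eq_adjoint, ContinuousLinearMap.adjoint_inner_left]

theorem tendsto_borelExt_apply {F : ℕ → X → ℂ} {M : ℝ} (hF : ∀ k, Measurable (F k))
    (hM : ∀ k x, ‖F k x‖ ≤ M) (h : ∀ x, Tendsto (fun k => F k x) atTop (𝓝 (g x))) (v : E) :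
    Tendsto (fun k => borelExt ρ μ (F k) v) atTop (𝓝 (borelExt ρ μ g v)) := by
  have hg : BddMeasurable g := ⟨measurable_of_tendsto_metrizable hF (tendsto_pi_nhds.2 h), M,
    fun x => le_of_tendsto' (h x).norm fun k => hM k x⟩
  have hFb : ∀ k, BddMeasurable (F k) := fun k => ⟨hF k, M, hM k⟩
  rw [tendsto_iff_edist_tendsto_0]
  have hlim : Tendsto (fun k => eLpNorm (F k - g) 2 (μ v)) atTop (𝓝 0) := by
    have h1 : Tendsto (fun k => ∫⁻ x, ‖F k x - g x‖ₑ ^ (2 : ℝ) ∂(μ v)) atTop (𝓝 0) := by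
      have h2 := tendsto_lintegral_of_dominated_convergence (μ := μ v)
        (F := fun k x => ‖F k x - g x‖ₑ ^ (2 : ℝ)) (f := fun _ => 0)
        (fun _ => ENNReal.ofReal (M + M) ^ (2 : ℝ)) (fun k => by
          have := ((hF k).sub hg.1).enorm
          fun_prop) (fun k => Eventually.of_forall fun x => ?_)
        (by simp [ENNReal.mul_eq_top, measure_ne_top]) (Eventually.of_forall fun x => ?_)
      · simpa using h2
      · refine ENNReal.rpow_le_rpow ?_ (by norm_num)
        rw [← ofReal_norm]
        refine ENNReal.ofReal_le_ofReal ((norm_sub_le _ _).trans (add_le_add (hM k x) ?_))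
        exact le_of_tendsto' (h x).norm fun k => hM k x
      · have h3 : Tendsto (fun k => ‖F k x - g x‖ₑ) atTop (𝓝 0) := by
          have := (tendsto_iff_edist_tendsto_0.1 (h x))
          simpa only [edist_eq_enorm_sub] using this
        have h4 := (ENNReal.continuous_rpow_const (y := 2)).tendsto 0 |>.comp h3
        simpa [Function.comp_def] using h4
    have h5 := (ENNReal.continuous_rpow_const (y := 1 / 2)).tendsto 0 |>.comp h1
    rw [ENNReal.zero_rpow_of_pos (by norm_num)] at h5
    refine h5.congr fun k => ?_
    rw [eLpNorm_eq_lintegral_rpow_enorm_toReal (by norm_num) (by norm_num)]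
    simp
  refine tendsto_of_tendsto_of_tendsto_of_le_of_le tendsto_const_nhds hlim (fun _ => zero_le)
    fun k => ?_
  rw [edist_eq_enorm_sub, ← sub_apply, ← borelExt_sub hμ (hFb k) hg]
  exact enorm_borelExt_le hμ ((hFb k).sub hg) v

omit hμ [∀ v, IsFiniteMeasure (μ v)] in
/-- The spectral measures of a representation of `C(X)`, from the Riesz–Markov–Kakutani
theorem. -/
theorem exists_representing_measure (ρ : C(X, ℂ) →⋆ₐ[ℂ] (E →L[ℂ] E)) (v : E) :
    ∃ ν : Measure X, IsFiniteMeasure ν ∧ ∀ f : C(X, ℂ), eLpNorm f 2 ν = ‖ρ f v‖ₑ := by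
  let c : C(X, ℝ) → C(X, ℂ) := fun f => ⟨fun x => (f x : ℂ), by fun_prop⟩
  have hsq : ∀ f : C(X, ℂ), ⟪v, ρ (star f * f) v⟫_ℂ = ((‖ρ f v‖ ^ 2 : ℝ) : ℂ) := fun f => by
    rw [map_mul, map_star, mul_apply_eq_comp, ContinuousLinearMap.star_eq_adjoint,
      ContinuousLinearMap.adjoint_inner_right, inner_self_eq_norm_sq_to_K]
    simp
  let L : C_c(X, ℝ) →ₗ[ℝ] ℝ :=
    { toFun := fun f => (⟪v, ρ (c f.toContinuousMap) v⟫_ℂ).re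
      map_add' := fun f g => by
        have : c (f + g).toContinuousMap = c f.toContinuousMap + c g.toContinuousMap := by
          ext x; simp [c]
        rw [this, map_add, add_apply, inner_add_right, Complex.add_re]
      map_smul' := fun a f => by
        have : c (a • f).toContinuousMap = (a : ℂ) • c f.toContinuousMap := by
          ext x; simp [c]
        rw [this, _root_.map_smul, smul_apply, inner_smul_right, Complex.re_ofReal_mul]
        rfl }
  -- Positivity: f = (√f)*√f turns the functional into ‖ρ(√f)v‖².
  let Λ : C_c(X, ℝ) →ₚ[ℝ] ℝ := PositiveLinearMap.mk₀ L fun f hf => by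
    let s : C(X, ℂ) := ⟨fun x => (√(f x) : ℂ), by fun_prop⟩
    have hs : c f.toContinuousMap = star s * s := by
      ext x
      have : 0 ≤ f x := hf x
      change ((f x : ℝ) : ℂ) = (starRingEnd ℂ) ((√(f x) : ℝ) : ℂ) * ((√(f x) : ℝ) : ℂ)
      rw [Complex.conj_ofReal, ← Complex.ofReal_mul, Real.mul_self_sqrt this]
    change 0 ≤ (⟪v, ρ (c f.toContinuousMap) v⟫_ℂ).re
    rw [hs, hsq, Complex.ofReal_re]
    positivity
  refine ⟨RealRMK.rieszMeasure Λ, inferInstance, fun f => ?_⟩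
  let q : C_c(X, ℝ) := ⟨⟨fun x => ‖f x‖ ^ 2, by fun_prop⟩, HasCompactSupport.of_compactSpace _⟩
  have h1 : ∫ x, ‖f x‖ ^ 2 ∂(RealRMK.rieszMeasure Λ) = ‖ρ f v‖ ^ 2 := by
    refine (RealRMK.integral_rieszMeasure Λ q).trans ?_
    change (⟪v, ρ (c q.toContinuousMap) v⟫_ℂ).re = _
    have hq : c q.toContinuousMap = star f * f := by
      ext x
      change ((‖f x‖ ^ 2 : ℝ) : ℂ) = (starRingEnd ℂ) (f x) * f x
      rw [Complex.conj_mul']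
      push_cast
      rfl
    rw [hq, hsq, Complex.ofReal_re]
  rw [((BddMeasurable.of_continuousMap f).memLp _).eLpNorm_eq_integral_rpow_norm (by norm_num)
    (by norm_num), ← ofReal_norm]
  congr 1
  have h2 : ∀ x, ‖f x‖ ^ (2 : ℝ≥0∞).toReal = ‖f x‖ ^ 2 := fun x => by simp
  simp only [h2, h1]
  rw [← Real.rpow_natCast, ← Real.rpow_mul (norm_nonneg _)]
  norm_num

end Representation

section SpectralTheorem

variable {E : Type*} [NormedAddCommGroup E] [InnerProductSpace ℂ E] [CompleteSpace E]
  {H : E →ₗ.[ℂ] E}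

/-! ### The Cayley transform of a self-adjoint operator -/

/-- The cross term vanishes since ⟨Hx, x⟩ is real and c is imaginary. Used at c = ±i, where it gives
‖(H + i)x‖ = ‖(H - i)x‖. -/
theorem norm_add_smul_sq (hH : IsSelfAdjoint H) {c : ℂ} (hre : c.re = 0) (hn : ‖c‖ = 1) {x x' : E}
    (hx : (x, x') ∈ H.graph) : ‖x' + c • x‖ ^ 2 = ‖x'‖ ^ 2 + ‖x‖ ^ 2 := by
  have h1 := inner_symm_of_isSelfAdjoint hH hx hx
  have him : (⟪x', x⟫_ℂ).im = 0 :=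
    Complex.conj_eq_iff_im.1 ((inner_conj_symm (𝕜 := ℂ) x x').trans h1.symm)
  rw [norm_add_sq (𝕜 := ℂ), inner_smul_right, norm_smul, hn, one_mul]
  have : RCLike.re (c * ⟪x', x⟫_ℂ) = 0 := by
    rw [RCLike.re_eq_complex_re, Complex.mul_re, hre, him]
    ring
  rw [this]
  ring

/-- H + c is bounded below in the graph norm, so its range is closed; a vector orthogonal to it
would be an eigenvector of H* = H with the non-real eigenvalue c. -/
theorem exists_mem_graph_add_smul_eq (hH : IsSelfAdjoint H) {c : ℂ} (hre : c.re = 0)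
    (hn : ‖c‖ = 1) (y : E) : ∃ x x', (x, x') ∈ H.graph ∧ x' + c • x = y := by
  let T : H.graph →L[ℂ] E :=
    (ContinuousLinearMap.snd ℂ E E + c • ContinuousLinearMap.fst ℂ E E).comp H.graph.subtypeL
  have hT : ∀ p : H.graph, T p = (p : E × E).2 + c • (p : E × E).1 := fun p => rfl
  have hcl : IsClosed (H.graph : Set (E × E)) := hH.isClosed
  have : CompleteSpace H.graph := hcl.completeSpace_coe
  have hanti : AntilipschitzWith 1 T := by
    refine ContinuousLinearMap.antilipschitz_of_bound _ fun p => ?_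
    have h := norm_add_smul_sq hH hre hn p.2
    rw [← hT] at h
    rw [NNReal.coe_one, one_mul]
    change max ‖(p : E × E).1‖ ‖(p : E × E).2‖ ≤ _
    refine max_le ?_ ?_ <;> refine abs_le_of_sq_le_sq' ?_ (norm_nonneg _) |>.2
    · nlinarith [sq_nonneg ‖(p : E × E).2‖]
    · nlinarith [sq_nonneg ‖(p : E × E).1‖]
  have hclosed : IsClosed (T.range : Set E) := by
    have h : (T.range : Set E) = Set.range T := by ext; simp
    rw [h]
    exact hanti.isClosed_range T.uniformContinuous
  have hdense : T.range = ⊤ := by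
    have : CompleteSpace T.range := hclosed.completeSpace_coe
    rw [← Submodule.orthogonal_eq_bot_iff, Submodule.eq_bot_iff]
    intro z hz
    have hc0 : c.im ≠ 0 := fun h0 => by
      have : c = 0 := Complex.ext hre h0
      simp [this] at hn
    refine eq_zero_of_mem_graph_smul hH hc0 ?_
    rw [mem_graph_iff_of_isSelfAdjoint hH]
    intro x x' hx
    have h1 := (Submodule.mem_orthogonal _ _).1 hz (T ⟨(x, x'), hx⟩) ⟨_, rfl⟩
    rw [hT, inner_add_left, inner_smul_left] at h1
    have hcc : (starRingEnd ℂ) c = -c := Complex.ext (by simp [hre]) (by simp)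
    rw [hcc] at h1
    rw [inner_smul_right]
    linear_combination h1
  obtain ⟨p, hp⟩ : y ∈ T.range := hdense ▸ Submodule.mem_top
  exact ⟨_, _, p.2, hp⟩

/-- A self-adjoint operator has a unitary Cayley transform `U = (H - i)(H + i)⁻¹`. -/
theorem exists_unitary_cayley (hH : IsSelfAdjoint H) : ∃ U ∈ unitary (E →L[ℂ] E),
    ∀ x x', (x, x') ∈ H.graph → U (x' + Complex.I • x) = x' - Complex.I • x := by
  have hI : Complex.I.re = 0 := by simp
  have hI' : (-Complex.I).re = 0 := by simp
  have hn' : ‖-Complex.I‖ = 1 := by simp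
  choose x x' hx hy using exists_mem_graph_add_smul_eq hH hI Complex.norm_I
  -- Injectivity of H + i makes the chosen preimages canonical, hence linear in the vector.
  have hinj : ∀ {a a' b b' : E}, (a, a') ∈ H.graph → (b, b') ∈ H.graph →
      a' + Complex.I • a = b' + Complex.I • b → a = b ∧ a' = b' := by
    intro a a' b b' ha hb hab
    have h1 := norm_add_smul_sq hH hI Complex.norm_I (H.graph.sub_mem ha hb)
    have h2 : (a' - b') + Complex.I • (a - b) = 0 := by
      rw [smul_sub, ← sub_eq_zero.2 hab]; abel
    rw [h2, norm_zero] at h1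
    constructor
    · rw [← sub_eq_zero, ← norm_eq_zero]
      nlinarith [sq_nonneg ‖a' - b'‖, sq_nonneg ‖a - b‖]
    · rw [← sub_eq_zero, ← norm_eq_zero]
      nlinarith [sq_nonneg ‖a' - b'‖, sq_nonneg ‖a - b‖]
  have hUs : ∀ {a a' : E}, (a, a') ∈ H.graph →
      x' (a' + Complex.I • a) - Complex.I • x (a' + Complex.I • a) = a' - Complex.I • a := by
    intro a a' ha
    obtain ⟨h1, h2⟩ := hinj (hx _) ha (hy _)
    rw [h1, h2]
  have hadd : ∀ v w, x' (v + w) - Complex.I • x (v + w) =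
      (x' v - Complex.I • x v) + (x' w - Complex.I • x w) := fun v w => by
    obtain ⟨h1, h2⟩ := hinj (hx (v + w)) (H.graph.add_mem (hx v) (hx w)) (by
      rw [hy, smul_add]
      nth_rewrite 1 [← hy v, ← hy w]
      abel)
    rw [h1, h2, smul_add]
    abel
  have hsmul : ∀ (a : ℂ) v, x' (a • v) - Complex.I • x (a • v) =
      a • (x' v - Complex.I • x v) := fun a v => by
    obtain ⟨h1, h2⟩ := hinj (hx (a • v)) (H.graph.smul_mem a (hx v)) (by
      rw [hy, smul_comm, ← smul_add, hy])
    rw [h1, h2, smul_comm, smul_sub]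
  have hnorm : ∀ v, ‖x' v - Complex.I • x v‖ = ‖v‖ := fun v => by
    have h1 := norm_add_smul_sq hH hI Complex.norm_I (hx v)
    have h2 := norm_add_smul_sq hH hI' hn' (hx v)
    rw [hy] at h1
    rw [neg_smul, ← sub_eq_add_neg, ← h1] at h2
    exact (sq_eq_sq₀ (norm_nonneg _) (norm_nonneg _)).1 h2
  let U₀ : E →ₗᵢ[ℂ] E :=
    { toFun := fun v => x' v - Complex.I • x v
      map_add' := hadd
      map_smul' := hsmul
      norm_map' := hnorm }
  have hsurj : Function.Surjective U₀ := fun y => by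
    obtain ⟨a, a', ha, hay⟩ := exists_mem_graph_add_smul_eq hH hI' hn' y
    refine ⟨a' + Complex.I • a, (hUs ha).trans ?_⟩
    rw [← hay, neg_smul, sub_eq_add_neg]
  refine ⟨Unitary.linearIsometryEquiv.symm (LinearIsometryEquiv.ofSurjective U₀ hsurj),
    (Unitary.linearIsometryEquiv.symm _).2, fun a a' ha => hUs ha⟩

/-! ### The inverse Cayley transform -/

/-- The inverse Cayley transform of the unit circle. -/
def cayleyInv (w : ℂ) : ℝ := (Complex.I * (1 + w) / (1 - w)).re

theorem measurable_cayleyInv : Measurable cayleyInv := by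
  unfold cayleyInv
  fun_prop

theorem ofReal_cayleyInv {w : ℂ} (hw : ‖w‖ = 1) (h1 : w ≠ 1) :
    ((cayleyInv w : ℝ) : ℂ) = Complex.I * (1 + w) / (1 - w) := by
  have hw0 : w ≠ 0 := by rintro rfl; simp at hw
  have hne : (1 : ℂ) - w ≠ 0 := sub_ne_zero.2 h1.symm
  have hne' : w - (1 : ℂ) ≠ 0 := sub_ne_zero.2 h1
  have hc : (starRingEnd ℂ) w = w⁻¹ := (Complex.inv_eq_conj hw).symm
  rw [cayleyInv, ← Complex.conj_eq_iff_re]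
  simp only [map_div₀, map_mul, map_add, map_sub, map_one, Complex.conj_I, hc]
  have hne'' : (1 : ℂ) - w⁻¹ ≠ 0 := by
    intro h
    apply h1
    field_simp at h
    linear_combination h
  field_simp
  ring

theorem inv_cayleyInv_add_I {w : ℂ} (hw : ‖w‖ = 1) (h1 : w ≠ 1) :
    ((cayleyInv w : ℝ) - -Complex.I : ℂ)⁻¹ = (1 - w) * (2 * Complex.I)⁻¹ := by
  have hne : (1 : ℂ) - w ≠ 0 := sub_ne_zero.2 h1.symm
  have hI := Complex.I_ne_zero
  rw [ofReal_cayleyInv hw h1, sub_neg_eq_add]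
  have : Complex.I * (1 + w) / (1 - w) + Complex.I = 2 * Complex.I / (1 - w) := by
    field_simp
    ring
  rw [this, inv_div, div_eq_mul_inv]

theorem exists_isBorelCalculus (hH : IsSelfAdjoint H) : ∃ Φ, IsBorelCalculus H Φ := by
  obtain ⟨U, hU, hUx⟩ := exists_unitary_cayley hH
  have hnormal : IsStarNormal U := isStarNormal_of_mem_unitary hU
  let ρ : C(spectrum ℂ U, ℂ) →⋆ₐ[ℂ] (E →L[ℂ] E) := cfcHom (p := IsStarNormal) hnormal
  have hρ : ρ ((ContinuousMap.id ℂ).restrict (spectrum ℂ U)) = U := cfcHom_id _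
  choose μ hfin hμ using exists_representing_measure ρ
  have hnorm : ∀ w : spectrum ℂ U, ‖(w : ℂ)‖ = 1 := fun w =>
    spectrum.norm_eq_one_of_unitary hU w.2
  let κ : spectrum ℂ U → ℝ := fun w => cayleyInv w
  have hκ : Measurable κ := measurable_cayleyInv.comp measurable_subtype_coe
  have hb : ∀ {f : ℝ → ℂ}, BddBorel f → BddMeasurable (f ∘ κ) := fun {f} hf =>
    ⟨hf.1.comp hκ, hf.2.imp fun M hM x => hM _⟩
  let Φ : (ℝ → ℂ) → (E →L[ℂ] E) := fun f => borelExt ρ μ (f ∘ κ)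
  have hconst : ∀ a : ℂ, Φ (fun _ => a) = a • (1 : E →L[ℂ] E) := fun a => by
    have h := borelExt_coe hμ (algebraMap ℂ C(spectrum ℂ U, ℂ) a)
    rw [AlgHomClass.commutes, Algebra.algebraMap_eq_smul_one (A := E →L[ℂ] E)] at h
    exact h
  have hadd : ∀ f g, BddBorel f → BddBorel g → Φ (fun s => f s + g s) = Φ f + Φ g :=
    fun f g hf hg => borelExt_add hμ (hb hf) (hb hg)
  have hmul : ∀ f g, BddBorel f → BddBorel g → Φ (fun s => f s * g s) = Φ f * Φ g :=
    fun f g hf hg => borelExt_mul hμ (hb hf) (hb hg)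
  have hsmul : ∀ (a : ℂ) f, BddBorel f → Φ (fun s => a * f s) = a • Φ f := fun a f hf => by
    rw [hmul _ _ (BddBorel.const a) hf, hconst, smul_mul_assoc, one_mul]
  let r : ℝ → ℂ := fun s => ((s : ℂ) - -Complex.I)⁻¹
  have hr : BddBorel r :=
    ⟨(bddBorel_resolvent (z := -Complex.I) (by simp)).1, _, (bddBorel_resolvent (by simp)).2⟩
  let q : C(spectrum ℂ U, ℂ) := 1 - (ContinuousMap.id ℂ).restrict (spectrum ℂ U)
  have hq : ∀ v, ρ q v = v - U v := fun v => by
    rw [map_sub, map_one, hρ, sub_apply, one_apply_eq_self]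
  have hinj : ∀ v, v - U v = 0 → v = 0 := fun v hv => by
    obtain ⟨x, x', hx, rfl⟩ := exists_mem_graph_add_smul_eq hH (c := Complex.I) (by simp)
      Complex.norm_I v
    rw [hUx x x' hx] at hv
    have h1 : (2 * Complex.I) • x = 0 := by rw [← hv, mul_smul, two_smul]; abel
    have h2 : x = 0 := (smul_eq_zero.1 h1).resolve_left (by simp)
    have h3 : x' = 0 := H.graph_fst_eq_zero_snd hx h2
    simp [h2, h3]
  have hrR : ∀ x x', (x, x') ∈ H.graph → Φ r (x' + Complex.I • x) = x := by
    intro x x' hx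
    -- On the spectrum, `e` can be non-zero only at w = 1, where division by zero gives `cayleyInv`
    -- the value 0. There q = 1 - w vanishes, so qe = 0, and injectivity of 1 - U shows that `e`
    -- contributes the zero operator.
    let e : spectrum ℂ U → ℂ := fun w => r (κ w) - (2 * Complex.I)⁻¹ * q w
    have he : BddMeasurable e := (hb hr).sub
      (BddMeasurable.of_continuousMap ((2 * Complex.I)⁻¹ • q))
    have hqe : ⇑q * e = 0 := by
      ext w
      by_cases hw : (w : ℂ) = 1
      · have : q w = 0 := by
          change 1 - (w : ℂ) = 0
          rw [hw, sub_self]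
        rw [Pi.mul_apply, this, zero_mul]
        rfl
      · have h1 : r (κ w) = (1 - (w : ℂ)) * (2 * Complex.I)⁻¹ :=
          inv_cayleyInv_add_I (hnorm w) hw
        have h2 : e w = 0 := by
          simp only [e, h1]
          change (1 - (w : ℂ)) * (2 * Complex.I)⁻¹ - (2 * Complex.I)⁻¹ * (1 - (w : ℂ)) = 0
          ring
        rw [Pi.mul_apply, h2, mul_zero]
        rfl
    have he0 : ∀ v, borelExt ρ μ e v = 0 := fun v => by
      refine hinj _ ?_
      rw [← hq, ← borelExt_mul_coe hμ q he, hqe]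
      have := borelExt_coe hμ 0
      rw [map_zero, ContinuousMap.coe_zero] at this
      rw [this, zero_apply]
    have hsplit : r ∘ κ = e + ⇑((2 * Complex.I)⁻¹ • q) := by
      ext w
      simp [e]
    change borelExt ρ μ (r ∘ κ) _ = x
    rw [hsplit, borelExt_add hμ he (BddMeasurable.of_continuousMap _), add_apply, he0, zero_add,
      borelExt_coe hμ, _root_.map_smul, smul_apply, hq, hUx x x' hx]
    have : x' + Complex.I • x - (x' - Complex.I • x) = (2 * Complex.I) • x := by
      rw [mul_smul, two_smul]; abel
    rw [this, smul_smul, inv_mul_cancel₀ (by simp), one_smul]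
  have hrg : ∀ v, (Φ r v, v - Complex.I • Φ r v) ∈ H.graph := fun v => by
    obtain ⟨x, x', hx, rfl⟩ := exists_mem_graph_add_smul_eq hH (c := Complex.I) (by simp)
      Complex.norm_I v
    rw [hrR x x' hx, add_sub_cancel_right]
    exact hx
  refine ⟨Φ, hconst, hadd, hmul, fun f hf => borelExt_star hμ (hb hf), ?_, fun z hz v => ?_⟩
  · exact fun F f M hF hM h v => tendsto_borelExt_apply hμ (fun k => (hF k).comp hκ)
      (fun k x => hM k _) (fun x => h _) v
  · set f : ℝ → ℂ := fun s => ((s : ℂ) - z)⁻¹ with hf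
    have hfb : BddBorel f := ⟨(bddBorel_resolvent hz).1, _, (bddBorel_resolvent hz).2⟩
    have hg : BddBorel fun s => 1 + (z + Complex.I) * f s :=
      (BddBorel.const 1).add ((BddBorel.const _).mul hfb)
    -- The resolvent identity reduces a general z to the point -i.
    have hrf : (fun s => r s * (1 + (z + Complex.I) * f s)) = f := by
      ext s
      have h1 := ofReal_sub_ne_zero s hz
      have h2 := ofReal_add_I_ne_zero s
      simp only [r, hf, sub_neg_eq_add]
      field_simp
      ring
    have h := hrg (Φ (fun s => 1 + (z + Complex.I) * f s) v)
    have h1 : Φ r (Φ (fun s => 1 + (z + Complex.I) * f s) v) = Φ f v := by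
      rw [← mul_apply_eq_comp, ← hmul _ _ hr hg, hrf]
    rw [h1, hadd _ _ (BddBorel.const 1) ((BddBorel.const _).mul hfb), hconst, hsmul _ _ hfb] at h
    convert h using 2
    simp only [add_apply, smul_apply, one_apply_eq_self, one_smul, add_smul]
    abel

end SpectralTheorem

/-- Rules out the default value 0 in the definition of `borelCalculus`. -/
theorem isBorelCalculus_borelCalculus {E : Type*} [NormedAddCommGroup E] [InnerProductSpace ℂ E]
    [CompleteSpace E] {H : E →ₗ.[ℂ] E} (hH : IsSelfAdjoint H) :
    IsBorelCalculus H (borelCalculus H) := by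
  have h := exists_isBorelCalculus hH
  rw [borelCalculus, dif_pos h]
  exact h.choose_spec

end Ballistic

end

/-! ### The main theorem. -/

theorem mainTheorem3 :
    ∃ c : ℝ, 0 < c ∧
      ∀ (d : ℕ) (_hd : 0 < d) (H : Ballistic.L2 d →ₗ.[ℂ] Ballistic.L2 d)
        (_hsa : IsSelfAdjoint H) (_hcomm : Ballistic.HasBoundedCommutator H)
        (I : Set ℝ) (_hI : MeasurableSet I)
        (_hpos : 0 < volume (I ∩ Ballistic.realSpectrum H))
        (θ : ℝ) (_hθ : 0 < θ) (_hM : Ballistic.StrictMourreEstimate H I θ)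
        (u : Ballistic.L2 d) (_hu : u ∈ Ballistic.weightedSpace d)
        (_hac : u ∈ Ballistic.acSubspace H),
        (∀ t : ℝ, Ballistic.propagator H t u ∈ Ballistic.weightedSpace d) ∧
        (∃ T : ℝ, ∀ t : ℝ, 0 < t → T ≤ t →
          c * √θ * ‖Ballistic.spectralProj H I u‖ ≤
            Ballistic.weightedNorm (Ballistic.propagator H t u) / t) ∧
        (∃ c' : ℝ, 0 < c' ∧ ∀ t : ℝ, 0 < t →
          c' * √θ * ‖Ballistic.spectralProj H I u‖ ≤
            Ballistic.weightedNorm (Ballistic.propagator H t u) / t) := by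
  refine ⟨1 / 8, by norm_num, fun d _ H hH hcomm I hI _ θ hθ hM u hu _ => ?_⟩
  obtain ⟨hcore, C, hC⟩ := hcomm
  obtain ⟨B, hB, hM⟩ := hM
  have hΦ := Ballistic.isBorelCalculus_borelCalculus hH
  have hU := Ballistic.commutatorBound_phase hH hcore hC hΦ
  set v : (Ballistic.weightOp d).domain := ⟨u, hu⟩
  have hnorm : ∀ t, Ballistic.weightedNorm (Ballistic.propagator H t u) =
      ‖Ballistic.weightOp d (Ballistic.orbit hU v t)‖ := fun t =>
    Ballistic.weightedNorm_eq_norm (Ballistic.orbit hU v t)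
  obtain ⟨T, hT⟩ := Ballistic.exists_forall_norm_weightOp_orbit_ge hH hcore hC hΦ hU hB hI hθ hM v
  have hlarge : ∀ t : ℝ, 0 < t → T ≤ t → 1 / 8 * √θ * ‖Ballistic.spectralProj H I u‖ ≤
      Ballistic.weightedNorm (Ballistic.propagator H t u) / t := fun t ht hTt => by
    rw [hnorm, le_div_iff₀ ht]
    exact hT t ht hTt
  -- For t ≤ T the second entry of the minimum gives c'√θ t ≤ t/(|T| + 1) ≤ 1, and ‖Pu‖ ≤ ‖u‖ =
  -- ‖u_t‖ ≤ ‖u_t‖₁ finishes.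
  refine ⟨fun t => (Ballistic.orbit hU v t).2, ⟨T, hlarge⟩,
    min (1 / 8) (1 / (√θ * (|T| + 1))), by positivity, fun t ht => ?_⟩
  rcases le_total T t with hTt | hTt
  · refine le_trans ?_ (hlarge t ht hTt)
    gcongr
    exact min_le_left _ _
  · have hsθ : 0 < √θ := Real.sqrt_pos.2 hθ
    have h1 : ‖Ballistic.spectralProj H I u‖ ≤ ‖u‖ := by
      have := hΦ.norm_apply_le (Ballistic.BddBorel.indicator hI).1 (M := 1)
        (fun s => by by_cases hs : s ∈ I <;> simp [hs]) u
      rw [one_mul] at this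
      exact this
    have h2 : ‖u‖ ≤ Ballistic.weightedNorm (Ballistic.propagator H t u) := by
      rw [hnorm, ← Ballistic.norm_phase_apply hΦ t u]
      exact Ballistic.norm_le_norm_weightOp (Ballistic.orbit hU v t)
    rw [le_div_iff₀ ht]
    have h3 : min (1 / 8) (1 / (√θ * (|T| + 1))) * √θ * t ≤ 1 := by
      calc _ ≤ 1 / (√θ * (|T| + 1)) * √θ * t := by
            gcongr
            exact min_le_right _ _
        _ = t / (|T| + 1) := by field_simp
        _ ≤ 1 := by
            rw [div_le_one (by positivity)]
            linarith [le_abs_self T]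
    calc _ = min (1 / 8) (1 / (√θ * (|T| + 1))) * √θ * t * ‖Ballistic.spectralProj H I u‖ := by ring
      _ ≤ 1 * ‖Ballistic.spectralProj H I u‖ := by gcongr
      _ ≤ _ := by rw [one_mul]; exact h1.trans h2
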